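/- **Setting.** Let $q$ and $n$ be probability densities with respect to a measure $dx$ on a measurable sample space, let $\Theta\subset\mathbb R^{m-1}$ be open, and let $\widetilde p(\cdot\mid\theta)$, $\theta\in\Theta$, be measurable nonnegative functions (a non-normalized model, which need not contain $q$). For $\xi=(\theta,c)\in\Theta\times\mathbb R$ put $p(x\mid\xi)=\widetilde p(x\mid\theta)e^{c}$, and for sizes $N,M>0$ let $$\rho_d(z,\xi)=-\log\frac{N p(z\mid\xi)}{N p(z\mid\xi)+M n(z)},\qquad \rho_n(z,\xi)=-\log\frac{M n(z)}{N p(z\mid\xi)+M n(z)},$$ $$d_{\rm NCE}(\xi)=E_q\{\rho_d(z,\xi)\}+\tfrac MN E_n\{\rho_n(z,\xi)\},$$ $$I(\xi)=\tfrac{N}{N+M}{\rm Cov}_q\{\nabla_\xi\rho_d(z,\xi)\}+\tfrac{M}{N+M}{\rm Cov}_n\{\nabla_\xi\rho_n(z,\xi)\},$$ $$J(\xi)=\tfrac{N}{N+M}E_q\{\nabla^2_\xi\rho_d(z,\xi)\}+\tfrac{M}{N+M}E_n\{\nabla^2_\xi\rho_n(z,\xi)\}.$$ All of these depend on $(N,M)$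 only through $M/N$. Let $N,M\to\infty$ along a sequence with $M/N\to\nu\in(0,\infty)$; a subscript $\nu$ denotes the value at $M/N=\nu$, and a subscript $N,M$ the value at the actual sizes. Let $x^{(1)},x^{(2)},\dots\sim q$ and $y^{(1)},y^{(2)},\dots\sim n$ be independent. Let $K\subset\Theta\times\mathbb R$ be compact, let the estimator $\hat\xi$ be a (measurable) minimizer over $K$ of $$\hat d_{\rm NCE}(\xi)=\frac1N\sum_{t=1}^N\rho_d(x^{(t)},\xi)+\frac1N\sum_{t=1}^M\rho_n(y^{(t)},\xi),$$ let $\xi^*_{N,M}$ be a minimizer of $d_{\rm NCE}$ over $K$, and suppose that $\xi^*=\xi^*_\nu$ is the unique minimizer over $K$ of $d_{\rm NCE}$ at $M/N=\nu$ and lies in the interior of $K$. **Assumptions.** (N1) For every $\theta\in\Theta$, $\widetilde p(z\mid\theta)\,dz$ is dominated by $n(z)\,dz$. (N2) For every $z$, $\widetilde p(z\mid\theta)>0$ on $\Theta$ and $\log \widetilde p(z\mid\theta)$ is $C^3$ in $\theta\in\Theta$. (N3) $E_q\{\nabla_\xi\rho_d\nabla_\xi\rho_d^\top\}$ and $E_n\{\nabla_\xi\rho_n\nabla_\xi\rho_n^\top\}$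 are finite at $\xi^*$ and $M/N=\nu$. (N4) There are functions $b_d,b_n$ with $E_q b_d<\infty$ and $E_n b_n<\infty$ such that $|\rho_d|$ and the absolute values of all second and third partial derivatives of $\rho_d$ in $\xi$ are at most $b_d(z)$, and likewise for $\rho_n$ and $b_n(z)$, for all $\xi\in K$ and all sizes $(N,M)$ of the sequence. (N5) $J_\nu(\xi^*)$ is nonsingular. Suppose moreover that $M/N-\nu=O(N^{-1/2})$, or else that the two matrices in (N3), evaluated at $\xi^*_{N,M}$ and the actual sizes, are finite and converge to those at $\xi^*$ and $M/N=\nu$. (The latter is automatic if $\xi^*_{N,M}=\xi^*$, for instance if $M/N=\nu$ or if the model contains $q$ with its parameter in the interior of $K$ and identifiable there.) **Conclusion.** In distribution, $$\sqrt{N+M}\,(\hat\xi-\xi^*_{N,M})\to N\{0,\;J_\nu(\xi^*)^{-1}I_\nu(\xi^*)J_\nu(\xi^*)^{-1}\},$$ equivalently $$\sqrt{N}\,(\hat\xi-\xi^*_{N,M})\to N\{0,\;(1+\nu)^{-1}J_\nu(\xi^*)^{-1}I_\nu(\xi^*)J_\nu(\xi^*)^{-1}\}.$$ No relation between $q$ and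 the model is assumed, so this holds under misspecification. -/

import Mathlib

open MeasureTheory ProbabilityTheory Filter Topology

noncomputable section

/-- The setting of noise contrastive estimation: a sample space `𝒳` with a reference measure `μ`
(the `dx` of all densities), the true density `q`, the noise density `n`, and a non-normalized
model `ptilde θ`, where `θ` ranges over an open set `Θ` of `ℝᵈ`. No relation between `q` and the
model is assumed. -/
structure NCESetting (𝒳 : Type*) [MeasurableSpace 𝒳] (d : ℕ) where
  μ : Measure 𝒳
  q : 𝒳 → ℝ
  n : 𝒳 → ℝ
  measurable_q : Measurable q
  measurable_n : Measurable n
  q_nonneg : ∀ z, 0 ≤ q z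
  n_nonneg : ∀ z, 0 ≤ n z
  lintegral_q : ∫⁻ z, ENNReal.ofReal (q z) ∂μ = 1
  lintegral_n : ∫⁻ z, ENNReal.ofReal (n z) ∂μ = 1
  Θ : Set (EuclideanSpace ℝ (Fin d))
  isOpen_Θ : IsOpen Θ
  ptilde : EuclideanSpace ℝ (Fin d) → 𝒳 → ℝ
  measurable_ptilde : ∀ θ ∈ Θ, Measurable (ptilde θ)
  ptilde_nonneg : ∀ θ ∈ Θ, ∀ z, 0 ≤ ptilde θ z

namespace NCESetting

/-- The extended parameter `ξ = (θ, c)`; its last coordinate is `c`, so `m = d + 1`. -/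
abbrev Param (d : ℕ) : Type := EuclideanSpace ℝ (Fin (d + 1))

/-- The component `θ` of `ξ = (θ, c)`. -/
def thetaPart {d : ℕ} (ξ : Param d) : EuclideanSpace ℝ (Fin d) :=
  WithLp.toLp 2 (fun i : Fin d => ξ (Fin.castSucc i))

/-- The component `c` of `ξ = (θ, c)`. -/
def cPart {d : ℕ} (ξ : Param d) : ℝ := ξ (Fin.last d)

/-- The `i`-th standard basis vector of the `ξ`-space. -/
def basisVec {d : ℕ} (i : Fin (d + 1)) : Param d := EuclideanSpace.single i (1 : ℝ)

/-- The partial derivative `∂f/∂ξᵢ`. -/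
def partial1 {d : ℕ} (f : Param d → ℝ) (i : Fin (d + 1)) (ξ : Param d) : ℝ :=
  fderiv ℝ f ξ (basisVec i)

/-- The partial derivative `∂²f/∂ξᵢ∂ξⱼ`. -/
def partial2 {d : ℕ} (f : Param d → ℝ) (i j : Fin (d + 1)) (ξ : Param d) : ℝ :=
  iteratedFDeriv ℝ 2 f ξ ![basisVec i, basisVec j]

/-- The partial derivative `∂³f/∂ξᵢ∂ξⱼ∂ξₖ`. -/
def partial3 {d : ℕ} (f : Param d → ℝ) (i j k : Fin (d + 1)) (ξ : Param d) : ℝ :=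
  iteratedFDeriv ℝ 3 f ξ ![basisVec i, basisVec j, basisVec k]

variable {𝒳 : Type*} [MeasurableSpace 𝒳] {d : ℕ} (S : NCESetting 𝒳 d)

/-- The distribution `q(x) dx` of the data. -/
def dataLaw : Measure 𝒳 := S.μ.withDensity (fun z => ENNReal.ofReal (S.q z))

/-- The distribution `n(y) dy` of the noise. -/
def noiseLaw : Measure 𝒳 := S.μ.withDensity (fun z => ENNReal.ofReal (S.n z))

/-- The non-normalized model with free normalization: `log p(z | θ, c) = log ptilde(z | θ) + c`. -/
def p (ξ : Param d) (z : 𝒳) : ℝ := S.ptilde (thetaPart ξ) z * Real.exp (cPart ξ)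

/-- `ρ_d(z, ξ) = - log (N p / (N p + M n))`. Here and below the sizes `N`, `M` are real numbers,
so that limiting values can be expressed: everything depends on `M / N` only, and the limit
`M / N → ν` corresponds to `(N, M) = (1, ν)`. -/
def rhoD (N M : ℝ) (z : 𝒳) (ξ : Param d) : ℝ :=
  -Real.log (N * S.p ξ z / (N * S.p ξ z + M * S.n z))

/-- `ρ_n(z, ξ) = - log (M n / (N p + M n))`. -/
def rhoN (N M : ℝ) (z : 𝒳) (ξ : Param d) : ℝ :=
  -Real.log (M * S.n z / (N * S.p ξ z + M * S.n z))

/-- The discrepancy `d_NCE(q, p_ξ) = E_q ρ_d(z, ξ) + (M / N) E_n ρ_n(z, ξ)`. -/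
def dNCE (N M : ℝ) (ξ : Param d) : ℝ :=
  (∫ z, S.rhoD N M z ξ ∂S.dataLaw) + M / N * ∫ z, S.rhoN N M z ξ ∂S.noiseLaw

/-- The objective function of noise contrastive estimation, computed from the first `N` data
points `x` and the first `M` noise points `y`. -/
def dHat (N M : ℕ) (x y : ℕ → 𝒳) (ξ : Param d) : ℝ :=
  1 / (N : ℝ) * ∑ t ∈ Finset.range N, S.rhoD N M (x t) ξ
    + 1 / (N : ℝ) * ∑ t ∈ Finset.range M, S.rhoN N M (y t) ξ

/-- `I(ξ) = N/(N+M) Cov_q(∇ρ_d(z, ξ)) + M/(N+M) Cov_n(∇ρ_n(z, ξ))`. -/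
def I (N M : ℝ) (ξ : Param d) : Matrix (Fin (d + 1)) (Fin (d + 1)) ℝ :=
  Matrix.of fun i j =>
    N / (N + M) * covariance (fun z => partial1 (S.rhoD N M z) i ξ)
        (fun z => partial1 (S.rhoD N M z) j ξ) S.dataLaw
      + M / (N + M) * covariance (fun z => partial1 (S.rhoN N M z) i ξ)
        (fun z => partial1 (S.rhoN N M z) j ξ) S.noiseLaw

/-- `J(ξ) = N/(N+M) E_q(∇²ρ_d(z, ξ)) + M/(N+M) E_n(∇²ρ_n(z, ξ))`. -/
def J (N M : ℝ) (ξ : Param d) : Matrix (Fin (d + 1)) (Fin (d + 1)) ℝ :=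
  Matrix.of fun i j =>
    N / (N + M) * ∫ z, partial2 (S.rhoD N M z) i j ξ ∂S.dataLaw
      + M / (N + M) * ∫ z, partial2 (S.rhoN N M z) i j ξ ∂S.noiseLaw

/-- The matrix `E_q(∇ρ_d(z, ξ) ∇ρ_d(z, ξ)ᵀ)`. -/
def gradMomentD (N M : ℝ) (ξ : Param d) : Matrix (Fin (d + 1)) (Fin (d + 1)) ℝ :=
  Matrix.of fun i j =>
    ∫ z, partial1 (S.rhoD N M z) i ξ * partial1 (S.rhoD N M z) j ξ ∂S.dataLaw

/-- The matrix `E_n(∇ρ_n(z, ξ) ∇ρ_n(z, ξ)ᵀ)`. -/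
def gradMomentN (N M : ℝ) (ξ : Param d) : Matrix (Fin (d + 1)) (Fin (d + 1)) ℝ :=
  Matrix.of fun i j =>
    ∫ z, partial1 (S.rhoN N M z) i ξ * partial1 (S.rhoN N M z) j ξ ∂S.noiseLaw

/-- Both `E_q(∇ρ_d ∇ρ_dᵀ)` and `E_n(∇ρ_n ∇ρ_nᵀ)` exist and are finite at `ξ`. -/
def GradMomentsFinite (N M : ℝ) (ξ : Param d) : Prop :=
  (∀ i j, Integrable
    (fun z => partial1 (S.rhoD N M z) i ξ * partial1 (S.rhoD N M z) j ξ) S.dataLaw) ∧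
  (∀ i j, Integrable
    (fun z => partial1 (S.rhoN N M z) i ξ * partial1 (S.rhoN N M z) j ξ) S.noiseLaw)

/-- (N1) Every model distribution is dominated by the noise distribution. -/
def N1 : Prop :=
  ∀ θ ∈ S.Θ, S.μ.withDensity (fun z => ENNReal.ofReal (S.ptilde θ z)) ≪ S.noiseLaw

/-- (N2) For every `z`, `log p(z | θ)` is finite and `C³` in `θ`. -/
def N2 : Prop :=
  ∀ z, (∀ θ ∈ S.Θ, 0 < S.ptilde θ z) ∧
    ContDiffOn ℝ 3 (fun θ => Real.log (S.ptilde θ z)) S.Θ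

/-- (N3) The second moments of the gradients are finite at the minimizer `ξ0` of the limiting
discrepancy. -/
def N3 (ν : ℝ) (ξ0 : Param d) : Prop := S.GradMomentsFinite 1 ν ξ0

/-- The second moments of the gradients at the minimizers `ξs s` for the sizes `(N s, M s)` are
finite and converge to those at the minimizer `ξ0` for the limiting ratio `ν`. -/
def GradMomentsConverge (N M : ℕ → ℕ) (ν : ℝ) (ξs : ℕ → Param d) (ξ0 : Param d) : Prop :=
  (∀ s, S.GradMomentsFinite (N s) (M s) (ξs s)) ∧
  Tendsto (fun s => S.gradMomentD (N s) (M s) (ξs s)) atTop (𝓝 (S.gradMomentD 1 ν ξ0)) ∧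
  Tendsto (fun s => S.gradMomentN (N s) (M s) (ξs s)) atTop (𝓝 (S.gradMomentN 1 ν ξ0))

/-- (N4) `ρ_d`, `ρ_n` and their second and third derivatives have integrable envelopes, uniformly
over the parameter set `K` and the sample sizes. -/
def N4 (K : Set (Param d)) (N M : ℕ → ℕ) : Prop :=
  ∃ bd bn : 𝒳 → ℝ, Integrable bd S.dataLaw ∧ Integrable bn S.noiseLaw ∧
    (∀ᵐ z ∂S.dataLaw, ∀ s, ∀ ξ ∈ K,
      |S.rhoD (N s) (M s) z ξ| ≤ bd z ∧
      (∀ i j, |partial2 (S.rhoD (N s) (M s) z) i j ξ| ≤ bd z) ∧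
      (∀ i j k, |partial3 (S.rhoD (N s) (M s) z) i j k ξ| ≤ bd z)) ∧
    (∀ᵐ z ∂S.noiseLaw, ∀ s, ∀ ξ ∈ K,
      |S.rhoN (N s) (M s) z ξ| ≤ bn z ∧
      (∀ i j, |partial2 (S.rhoN (N s) (M s) z) i j ξ| ≤ bn z) ∧
      (∀ i j k, |partial3 (S.rhoN (N s) (M s) z) i j k ξ| ≤ bn z))

/-- (N5) The limiting matrix `J` is nonsingular. -/
def N5 (ν : ℝ) (ξ0 : Param d) : Prop := IsUnit (S.J 1 ν ξ0)

end NCESetting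

end

/-! The free normalization absorbs the ratio of the sample sizes. In both losses only the proportion
of `N p` to `M n` matters, and rescaling `p` is a translation of `c`. So the losses for sizes `(N,
M)` are the losses for `(1, ν)` evaluated at `ξ - a`, where `a` is `log ((M / N) / ν)` times the
last basis vector (`rhoD_eq_shift`, `rhoN_eq_shift`). What still varies is the weight `M / N` of the
noise term and the vanishing shift `a`. The claim thus becomes one about two-sample M-estimators
with fixed smooth losses, `tendstoInDistribution_estimator`.

A strong law in a space of continuous functions (`uniform_strong_law`) makes the empirical criteria
converge uniformly on a compact set containing `K` and its translates, so their minimizers converge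
almost surely (`tendsto_of_isMinOn_shift`). The same law for the second derivatives, with the mean
value inequality, makes increments of the empirical gradient near `ξ0` linear up to a relative error
`o(1)`, with matrix the limiting Hessian `H` (`isLittleO_gradient_sub_vec`). The minimizers are
eventually interior, so the empirical gradient vanishes at the estimator and the expected gradient
at the population minimizer. Hence `Δ = √N (ξhat - ξs)` satisfies `H Δ + W = o(Δ)` almost surely,
where `W` is the normalized centred score at the population minimizer. As `H` is invertible, `Δ = T
+ o(T)` with `T = -H⁻¹ W`, without any prior rate for `Δ` (`isLittleO_of_linear_equation`), and `Δ`
inherits the limit law of `T` (`tendstoInDistribution_of_sub_isLittleO`).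

The score at the fixed point `ξ0` obeys `two_sample_clt`, but `W` is taken at moving points. If `M /
N - ν = O(N^(-1/2))`, these points are within `O(N^(-1/2))` of `ξ0` (`isBigO_sub_of_critical`), and
the score changes by `o(1)` because the Jacobian of empirical minus expected gradient tends to zero.
If the second moments converge instead, the gradients converge in mean square, and Chebyshev's
inequality bounds the change. Finally `J` and `I` are `(1 + ν)⁻¹` times `H` and the score
covariance, which accounts for the factor between the `√N` and `√(N + M)` scalings. -/

noncomputable section

/-! ### Measurability in function spaces and the uniform strong law. -/

/-- A map into a second countable metric space is measurable as soon as its distances to all fixed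
points are. -/
lemma measurable_of_measurable_dist {α β : Type*} [MeasurableSpace α] [PseudoMetricSpace β]
    [SecondCountableTopology β] [MeasurableSpace β] [BorelSpace β] {f : α → β}
    (h : ∀ y, Measurable fun x => dist (f x) y) : Measurable f := by
  refine measurable_of_isOpen fun O hO => ?_
  have hcov : ∀ y : O, ∃ r > 0, Metric.ball (y : β) r ⊆ O := fun y =>
    Metric.isOpen_iff.1 hO y y.2
  choose r hr0 hr using hcov
  -- By the Lindelöf property countably many balls suffice, and the preimage of a ball is a sublevel
  -- set of a measurable distance.
  obtain ⟨T, hT, hTeq⟩ := TopologicalSpace.isOpen_iUnion_countable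
    (fun y : O => Metric.ball (y : β) (r y)) (fun y => Metric.isOpen_ball)
  have hO' : O = ⋃ y ∈ T, Metric.ball (y : β) (r y) := by
    rw [hTeq]
    refine Set.Subset.antisymm (fun y hy => ?_) (Set.iUnion_subset hr)
    exact Set.mem_iUnion.2 ⟨⟨y, hy⟩, Metric.mem_ball_self (hr0 _)⟩
  rw [hO', Set.preimage_iUnion₂]
  exact MeasurableSet.biUnion hT fun y _ => (h y) measurableSet_Iio

/-- A family of continuous functions on a compact space depends measurably on a parameter as soon
as each of its values does. -/
lemma measurable_continuousMap_of_eval {α T : Type*} [MeasurableSpace α] [MetricSpace T]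
    [CompactSpace T] [MeasurableSpace C(T, ℝ)] [BorelSpace C(T, ℝ)] {Φ : α → C(T, ℝ)}
    (h : ∀ t, Measurable fun x => Φ x t) : Measurable Φ := by
  refine measurable_of_measurable_dist fun g => measurable_of_Iic fun r => ?_
  rcases lt_or_ge r 0 with hr | hr
  · convert MeasurableSet.empty
    ext x
    simpa using hr.trans_le dist_nonneg
  obtain ⟨D, hDc, hD⟩ := TopologicalSpace.exists_countable_dense T
  -- By continuity, a sup-distance bound need only be tested on a countable dense set.
  have : (fun x => dist (Φ x) g) ⁻¹' Set.Iic r = ⋂ t ∈ D, {x | dist (Φ x t) (g t) ≤ r} := by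
    ext x
    simp only [Set.mem_preimage, Set.mem_Iic, Set.mem_iInter, Set.mem_ofPred_eq]
    rw [ContinuousMap.dist_le hr]
    refine ⟨fun H t _ => H t, fun H t => ?_⟩
    have hc : IsClosed {t | dist (Φ x t) (g t) ≤ r} := isClosed_le (by fun_prop) (by fun_prop)
    have := hc.closure_subset_iff.2 (fun t ht => H t ht : D ⊆ _)
    exact this (by simp [hD.closure_eq])
  rw [this]
  exact MeasurableSet.biInter hDc fun t _ =>
    measurableSet_le ((h t).dist measurable_const) measurable_const

lemma identDistrib_of_hasLaw {Ω 𝒳 : Type*} [MeasurableSpace Ω] [MeasurableSpace 𝒳]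
    {P : Measure Ω} {Q : Measure 𝒳} {X Y : Ω → 𝒳} (hX : HasLaw X Q P) (hY : HasLaw Y Q P) :
    IdentDistrib X Y P P :=
  ⟨hX.aemeasurable, hY.aemeasurable, hX.map_eq.trans hY.map_eq.symm⟩

/-- Uniform strong law of large numbers over a compact set for a dominated family of continuous
functions; the expectations depend continuously on the parameter. -/
theorem uniform_strong_law {Ω 𝒳 E : Type*} [MeasurableSpace Ω] [MeasurableSpace 𝒳] [MetricSpace E]
    {P : Measure Ω} [IsProbabilityMeasure P] {Q : Measure 𝒳} {X : ℕ → Ω → 𝒳}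
    (hX : ∀ t, HasLaw (X t) Q P) (hind : iIndepFun X P) {L : Set E} (hL : IsCompact L)
    {φ : 𝒳 → E → ℝ} (hφm : ∀ ξ ∈ L, Measurable fun z => φ z ξ)
    (hφc : ∀ z, ContinuousOn (φ z) L) {b : 𝒳 → ℝ} (hb : Integrable b Q)
    (hφb : ∀ᵐ z ∂Q, ∀ ξ ∈ L, |φ z ξ| ≤ b z) :
    (∀ᵐ ω ∂P, TendstoUniformlyOn (fun (n : ℕ) ξ => (n : ℝ)⁻¹ * ∑ t ∈ Finset.range n, φ (X t ω) ξ)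
      (fun ξ => ∫ z, φ z ξ ∂Q) atTop L) ∧ ContinuousOn (fun ξ => ∫ z, φ z ξ ∂Q) L := by
  have hcs : CompactSpace L := isCompact_iff_compactSpace.1 hL
  borelize C(L, ℝ)
  -- Viewed as a random element of the separable Banach space `C(L, ℝ)`, the family obeys the
  -- Banach-valued strong law, whose norm convergence is uniform convergence. Its Bochner integral
  -- is itself a continuous function, which gives the continuity claim.
  let Φ : 𝒳 → C(L, ℝ) := fun z => ⟨L.domRestrict (φ z), (hφc z).domRestrict⟩
  have hΦm : Measurable Φ := measurable_continuousMap_of_eval fun ξ => hφm ξ ξ.2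
  have hΦi : Integrable Φ Q := by
    refine hb.norm.mono' hΦm.stronglyMeasurable.aestronglyMeasurable ?_
    filter_upwards [hφb] with z hz
    exact (ContinuousMap.norm_le _ (norm_nonneg _)).2 fun ξ => (hz ξ ξ.2).trans (le_abs_self _)
  have heval : ∀ ξ : L, (∫ z, Φ z ∂Q) ξ = ∫ z, φ z ξ ∂Q := fun ξ => by
    rw [← ContinuousMap.evalCLM_apply ℝ ξ, ← ContinuousLinearMap.integral_comp_comm _ hΦi]
    rfl
  have hcont : ContinuousOn (fun ξ => ∫ z, φ z ξ ∂Q) L := by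
    rw [continuousOn_iff_continuous_domRestrict]
    convert (∫ z, Φ z ∂Q).continuous using 1
    exact funext fun ξ => (heval ξ).symm
  refine ⟨?_, hcont⟩
  have hΦX : ∀ t, AEMeasurable (Φ ∘ X t) P := fun t => hΦm.comp_aemeasurable (hX t).aemeasurable
  have hlaw := strong_law_ae (μ := P) (fun t => Φ ∘ X t) ?_ ?_ ?_
  · filter_upwards [hlaw] with ω hω
    have hE : P[Φ ∘ X 0] = ∫ z, Φ z ∂Q :=
      (hX 0).integral_comp hΦm.stronglyMeasurable.aestronglyMeasurable
    rw [hE] at hω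
    have hu := (ContinuousMap.tendsto_iff_tendstoUniformly.1 hω)
    rw [tendstoUniformlyOn_iff_tendstoUniformly_comp_coe]
    convert hu using 1
    · ext n ξ
      rw [ContinuousMap.smul_apply, ContinuousMap.sum_apply, smul_eq_mul]
      rfl
    · ext ξ
      exact (heval ξ).symm
  · refine Integrable.comp_aemeasurable ?_ (hX 0).aemeasurable
    rwa [(hX 0).map_eq]
  · intro s t hst
    exact (hind.indepFun hst).comp hΦm hΦm
  · intro t
    exact (identDistrib_of_hasLaw (hX t) (hX 0)).comp hΦm

/-! ### Convergence of minimizers. -/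

/-- Minimizers of functions converging uniformly on a compact set, with shifted arguments, converge
to the unique minimizer of the limit. -/
theorem tendsto_of_isMinOn_shift {E : Type*} [NormedAddCommGroup E] {K L : Set E}
    (hK : IsCompact K) (hL : IsCompact L) (hKL : K ⊆ L) {D : E → ℝ} (hD : ContinuousOn D L)
    {Ds : ℕ → E → ℝ} (hDs : TendstoUniformlyOn Ds D atTop L) {a : ℕ → E}
    (ha : Tendsto a atTop (𝓝 0)) (haL : ∀ s, ∀ ξ ∈ K, ξ - a s ∈ L) {ξ0 : E} (h0 : ξ0 ∈ K)
    (hmin : ∀ ξ ∈ K, ξ ≠ ξ0 → D ξ0 < D ξ) {x : ℕ → E} (hx : ∀ᶠ s in atTop, x s ∈ K)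
    (hxmin : ∀ᶠ s in atTop, IsMinOn (fun ξ => Ds s (ξ - a s)) K (x s)) :
    Tendsto x atTop (𝓝 ξ0) := by
  have hunif : TendstoUniformlyOn (fun s ξ => Ds s (ξ - a s)) D atTop K := by
    rw [Metric.tendstoUniformlyOn_iff] at hDs ⊢
    intro ε hε
    -- The shift is absorbed by uniform continuity of the limit; the functions `Ds s` need no
    -- equicontinuity.
    have huc := hL.uniformContinuousOn_of_continuous hD
    obtain ⟨δ, hδ, hδ'⟩ := Metric.uniformContinuousOn_iff.1 huc (ε / 2) (half_pos hε)
    filter_upwards [hDs (ε / 2) (half_pos hε), ha (Metric.ball_mem_nhds 0 hδ)] with s hs hs' ξ hξ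
    have h1 := hs (ξ - a s) (haL s ξ hξ)
    have h2 := hδ' ξ (hKL hξ) (ξ - a s) (haL s ξ hξ) (by simpa [dist_eq_norm] using hs')
    linarith [dist_triangle (D ξ) (D (ξ - a s)) (Ds s (ξ - a s))]
  rw [tendsto_nhds]
  intro U hU hξU
  rcases (K \ U).eq_empty_or_nonempty with he | hne
  · filter_upwards [hx] with s hs
    by_contra hcon
    exact (Set.eq_empty_iff_forall_notMem.1 he) _ ⟨hs, hcon⟩
  -- Outside `U` the limit exceeds `D ξ0` by a positive gap, attained by compactness. A uniform
  -- error below half this gap rules out minimizers there.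
  obtain ⟨m, hm, hmm⟩ := (hK.diff hU).exists_isMinOn hne
    (hD.mono (Set.sdiff_subset.trans hKL))
  have hlt : D ξ0 < D m := hmin m hm.1 fun h => hm.2 (h ▸ hξU)
  filter_upwards [Metric.tendstoUniformlyOn_iff.1 hunif ((D m - D ξ0) / 2) (by linarith), hx, hxmin]
    with s hs hxs hms
  by_contra hcon
  have h1 := hs _ hxs
  have h2 := hs _ h0
  have h3 : Ds s (x s - a s) ≤ Ds s (ξ0 - a s) := hms h0
  have h4 : D m ≤ D (x s) := hmm ⟨hxs, hcon⟩
  rw [Real.dist_eq, abs_lt] at h1 h2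
  linarith [h1.1, h1.2, h2.1, h2.2]

namespace NCESetting

/-! ### Differential calculus in coordinates. -/

section Calculus

variable {d : ℕ}

/-- The linear form with the given coefficients. -/
def coordForm (c : Fin (d + 1) → ℝ) : Param d →L[ℝ] ℝ :=
  ∑ j, c j • EuclideanSpace.proj j

@[simp]
lemma coordForm_apply (c : Fin (d + 1) → ℝ) (v : Param d) : coordForm c v = ∑ j, c j * v j := by
  simp [coordForm]

lemma coordForm_basisVec (c : Fin (d + 1) → ℝ) (i : Fin (d + 1)) :
    coordForm c (basisVec i) = c i := by
  simp [basisVec]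

lemma coordForm_sub (c c' : Fin (d + 1) → ℝ) :
    coordForm c - coordForm c' = coordForm fun j => c j - c' j := by
  ext v; simp [sub_mul, Finset.sum_sub_distrib]

lemma coordForm_add (c c' : Fin (d + 1) → ℝ) :
    coordForm c + coordForm c' = coordForm fun j => c j + c' j := by
  ext v; simp [add_mul, Finset.sum_add_distrib]

lemma coordForm_smul (r : ℝ) (c : Fin (d + 1) → ℝ) :
    r • coordForm c = coordForm fun j => r * c j := by
  ext v; simp [mul_assoc, Finset.mul_sum]

lemma coordForm_sum {κ : Type*} (s : Finset κ) (c : κ → Fin (d + 1) → ℝ) :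
    ∑ k ∈ s, coordForm (c k) = coordForm fun j => ∑ k ∈ s, c k j := by
  ext v
  simp only [sum_apply, coordForm_apply, Finset.sum_mul]
  exact Finset.sum_comm

lemma sum_smul_basisVec (v : Param d) : ∑ j, v j • (basisVec j : Param d) = v := by
  ext i
  simp [basisVec, Pi.single_apply, Finset.sum_apply]

lemma eq_coordForm (A : Param d →L[ℝ] ℝ) : A = coordForm fun j => A (basisVec j) := by
  ext v
  conv_lhs => rw [← sum_smul_basisVec v]
  simp [mul_comm]

lemma norm_coordForm_le (c : Fin (d + 1) → ℝ) : ‖coordForm c‖ ≤ ∑ j, |c j| := by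
  refine ContinuousLinearMap.opNorm_le_bound _ (by positivity) fun v => ?_
  rw [coordForm_apply, Finset.sum_mul]
  refine (norm_sum_le _ _).trans (Finset.sum_le_sum fun j _ => ?_)
  rw [norm_mul, Real.norm_eq_abs]
  gcongr
  exact PiLp.norm_apply_le v j

lemma hasFDerivAt_coordForm {f : Param d → ℝ} {ξ : Param d} (h : DifferentiableAt ℝ f ξ) :
    HasFDerivAt f (coordForm fun i => partial1 f i ξ) ξ := by
  exact h.hasFDerivAt.congr_fderiv (eq_coordForm _)

/-- The outer derivative occupies the first slot of the iterated derivative, hence the index order;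
symmetry is not needed. -/
lemma hasFDerivAt_partial1 {f : Param d → ℝ} {ξ : Param d} (h : ContDiffAt ℝ 2 f ξ)
    (j : Fin (d + 1)) : HasFDerivAt (partial1 f j) (coordForm fun i => partial2 f i j ξ) ξ := by
  have h1 : ContDiffAt ℝ 1 (fderiv ℝ f) ξ := h.fderiv_right (by norm_num)
  have h2 := (h1.differentiableAt one_ne_zero).hasFDerivAt.clm_apply
    (hasFDerivAt_const (basisVec j : Param d) ξ)
  refine h2.congr_fderiv ((eq_coordForm _).trans ?_)
  congr 1
  ext i
  simp [partial2, iteratedFDeriv_two_apply]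

lemma partial2_comm {f : Param d → ℝ} {ξ : Param d} (h : ContDiffAt ℝ 2 f ξ)
    (i j : Fin (d + 1)) : partial2 f i j ξ = partial2 f j i ξ := by
  have := h.isSymmSndFDerivAt (by simp)
  simpa [partial2, iteratedFDeriv_two_apply] using this (basisVec i) (basisVec j)

lemma continuousAt_partial2 {f : Param d → ℝ} {ξ : Param d} (h : ContDiffAt ℝ 2 f ξ)
    (i j : Fin (d + 1)) : ContinuousAt (partial2 f i j) ξ := by
  have h1 : ContDiffAt ℝ 0 (iteratedFDeriv ℝ 2 f) ξ := h.iteratedFDeriv_right (by norm_num)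
  exact (ContinuousMultilinearMap.apply ℝ (fun _ : Fin 2 => Param d) ℝ
    ![basisVec i, basisVec j]).continuous.continuousAt.comp h1.continuousAt

/-- Along sequences converging to `ξ0`, increments of gradients whose Jacobians converge uniformly
near `ξ0` are linear up to a negligible error. -/
lemma isLittleO_gradient_sub {p : ℕ → Fin (d + 1) → Param d → ℝ}
    {q : ℕ → Fin (d + 1) → Fin (d + 1) → Param d → ℝ} {h : Fin (d + 1) → Fin (d + 1) → Param d → ℝ}
    {ξ0 : Param d} {δ : ℝ} (hδ : 0 < δ)
    (hp : ∀ s j, ∀ ξ ∈ Metric.ball ξ0 δ, HasFDerivAt (p s j) (coordForm fun i => q s i j ξ) ξ)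
    (hq : ∀ i j, TendstoUniformlyOn (fun s => q s i j) (h i j) atTop (Metric.ball ξ0 δ))
    (hh : ∀ i j, ContinuousAt (h i j) ξ0) {x y : ℕ → Param d} (hx : Tendsto x atTop (𝓝 ξ0))
    (hy : Tendsto y atTop (𝓝 ξ0)) (j : Fin (d + 1)) :
    (fun s => p s j (x s) - p s j (y s) - ∑ i, h i j ξ0 * (x s - y s) i) =o[atTop]
      fun s => x s - y s := by
  rw [Asymptotics.isLittleO_iff]
  intro ε hε
  -- The operator norm of the Jacobian error is at most the sum of `d + 1` coefficient errors. Each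
  -- may cost `η`, half for uniform convergence and half for continuity of the limit.
  set η := ε / (d + 1) with hη
  have hη0 : 0 < η := by positivity
  have hcont : ∀ᶠ ξ in 𝓝 ξ0, ∀ i, |h i j ξ - h i j ξ0| < η / 2 := by
    rw [eventually_all]
    intro i
    exact Metric.tendsto_nhds.1 (hh i j) (η / 2) (half_pos hη0)
  obtain ⟨δ', hδ', hball⟩ := Metric.eventually_nhds_iff_ball.1 hcont
  have hm : 0 < min δ δ' := lt_min hδ hδ'
  have hu : ∀ᶠ s in atTop, ∀ i, ∀ ξ ∈ Metric.ball ξ0 δ, dist (h i j ξ) (q s i j ξ) < η / 2 := by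
    rw [eventually_all]
    intro i
    exact Metric.tendstoUniformlyOn_iff.1 (hq i j) (η / 2) (half_pos hη0)
  filter_upwards [hu, hx (Metric.ball_mem_nhds _ hm), hy (Metric.ball_mem_nhds _ hm)]
    with s hs hxs hys
  -- Mean value inequality for `p s j` minus the fixed linear map with coefficients `h i j ξ0`.
  have key := (convex_ball ξ0 (min δ δ')).norm_image_sub_le_of_norm_hasFDerivWithin_le'
    (f := p s j) (f' := fun ξ => coordForm fun i => q s i j ξ)
    (φ := coordForm fun i => h i j ξ0) (C := ε)
    (fun ξ hξ => (hp s j ξ (Metric.ball_subset_ball (min_le_left _ _) hξ)).hasFDerivWithinAt)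
    (fun ξ hξ => ?_) hys hxs
  · simpa using key
  · rw [coordForm_sub]
    refine (norm_coordForm_le _).trans ?_
    have : ∀ i ∈ Finset.univ, |q s i j ξ - h i j ξ0| ≤ η := fun i _ => by
      have h1 := hs i ξ (Metric.ball_subset_ball (min_le_left _ _) hξ)
      have h2 := hball ξ (Metric.ball_subset_ball (min_le_right _ _) hξ) i
      rw [dist_comm, Real.dist_eq] at h1
      linarith [abs_sub_le (q s i j ξ) (h i j ξ) (h i j ξ0)]
    refine (Finset.sum_le_sum this).trans (le_of_eq ?_)
    simp [hη]
    field_simp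

/-- A function on a ball that is bounded together with its second partial derivatives has bounded
first partial derivatives on a smaller ball. -/
lemma abs_partial1_le {f : Param d → ℝ} {ξ0 : Param d} {δ B : ℝ} (hδ : 0 < δ)
    (hf : ContDiffOn ℝ 2 f (Metric.ball ξ0 δ)) (h0 : ∀ ξ ∈ Metric.ball ξ0 δ, |f ξ| ≤ B)
    (h2 : ∀ ξ ∈ Metric.ball ξ0 δ, ∀ i j, |partial2 f i j ξ| ≤ B) {ξ : Param d}
    (hξ : ξ ∈ Metric.closedBall ξ0 (δ / 2)) (i : Fin (d + 1)) :
    |partial1 f i ξ| ≤ (8 / δ + δ / 4) * B := by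
  have hCD : ∀ ζ ∈ Metric.ball ξ0 δ, ContDiffAt ℝ 2 f ζ := fun ζ hζ =>
    hf.contDiffAt (Metric.isOpen_ball.mem_nhds hζ)
  have hn : ‖(basisVec i : Param d)‖ = 1 := by simp [basisVec]
  -- Landau-type interpolation: a difference quotient of step `δ / 4` equals the partial derivative
  -- at an intermediate point and is at most `(4 / δ) * 2B`. Moving back to `ξ` costs at most `δ /
  -- 4` times the bound on the second derivative.
  set ζ : Param d := ξ + (δ / 4) • basisVec i with hζ
  have hζd : dist ζ ξ = δ / 4 := by simp [hζ, norm_smul, hn, abs_of_pos hδ]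
  have hξb : ξ ∈ Metric.ball ξ0 δ := Metric.closedBall_subset_ball (by linarith) hξ
  have hζb : ζ ∈ Metric.ball ξ0 δ := by
    rw [Metric.mem_ball]
    linarith [dist_triangle ζ ξ ξ0, Metric.mem_closedBall.1 hξ]
  obtain ⟨m, hm, hmeq⟩ := domain_mvt (f := f) (f' := fun x => coordForm fun i => partial1 f i x)
    (fun x hx => (hasFDerivAt_coordForm
      ((hCD x hx).differentiableAt two_ne_zero)).hasFDerivWithinAt)
    (convex_ball ξ0 δ) hξb hζb
  have hζξ : ζ - ξ = (δ / 4) • basisVec i := by simp [hζ]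
  rw [hζξ, map_smul, coordForm_basisVec, smul_eq_mul] at hmeq
  have hmb : m ∈ Metric.ball ξ0 δ := (convex_ball ξ0 δ).segment_subset hξb hζb hm
  obtain ⟨m', hm', hmeq'⟩ := domain_mvt (f := partial1 f i)
    (f' := fun x => coordForm fun k => partial2 f k i x)
    (fun x hx => (hasFDerivAt_partial1 (hCD x hx) i).hasFDerivWithinAt)
    (convex_ball ξ0 δ) hξb hmb
  have hm'b : m' ∈ Metric.ball ξ0 δ := (convex_ball ξ0 δ).segment_subset hξb hmb hm'
  -- Writing the point of the segment explicitly shows that the displacement from `ξ` is a multiple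
  -- of `basisVec i`, so only the `(i, i)` second derivative enters.
  obtain ⟨t, ht, rfl⟩ : ∃ t ∈ Set.Icc (0 : ℝ) 1, ξ + t • (ζ - ξ) = m := by
    rw [segment_eq_image'] at hm
    obtain ⟨t, ht, h⟩ := hm
    exact ⟨t, ht, h⟩
  rw [hζξ, smul_smul] at hmeq
  rw [hζξ, add_sub_cancel_left, smul_smul, map_smul, coordForm_basisVec, smul_eq_mul] at hmeq'
  have hB : 0 ≤ B := (abs_nonneg _).trans (h0 ξ hξb)
  set A := partial1 f i (ξ + (t * (δ / 4)) • basisVec i)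
  have hA : |A| ≤ 8 / δ * B := by
    have : A = 4 / δ * (f ζ - f ξ) := by rw [hmeq]; field_simp
    rw [this, abs_mul, abs_of_pos (by positivity)]
    have := abs_sub (f ζ) (f ξ)
    calc 4 / δ * |f ζ - f ξ| ≤ 4 / δ * (B + B) := by
          gcongr
          exact this.trans (add_le_add (h0 _ hζb) (h0 _ hξb))
      _ = 8 / δ * B := by ring
  have hA' : |A - partial1 f i ξ| ≤ δ / 4 * B := by
    rw [hmeq', abs_mul, abs_of_nonneg (mul_nonneg ht.1 (by positivity))]
    gcongr
    · nlinarith [ht.2]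
    · exact h2 _ hm'b i i
  calc |partial1 f i ξ| = |A - (A - partial1 f i ξ)| := by congr 1; ring
    _ ≤ |A| + |A - partial1 f i ξ| := abs_sub _ _
    _ ≤ _ := by rw [add_mul]; exact add_le_add hA hA'

end Calculus

/-! ### Measurability of derivatives and differentiation under the integral. -/

section Integral

variable {𝒳 : Type*} [MeasurableSpace 𝒳] {d : ℕ}

/-- A partial derivative is a pointwise limit of measurable difference quotients. -/
lemma measurable_of_hasFDerivAt_coordForm {φ : 𝒳 → Param d → ℝ} {c : 𝒳 → Fin (d + 1) → ℝ}
    {U : Set (Param d)} {ξ : Param d} (hU : U ∈ 𝓝 ξ) (hm : ∀ ζ ∈ U, Measurable fun z => φ z ζ)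
    (hd : ∀ z, HasFDerivAt (φ z) (coordForm (c z)) ξ) (i : Fin (d + 1)) :
    Measurable fun z => c z i := by
  have hlim : Tendsto (fun n : ℕ => ξ + ((n : ℝ))⁻¹ • (basisVec i : Param d)) atTop (𝓝 ξ) := by
    have := (tendsto_inv_atTop_nhds_zero_nat (𝕜 := ℝ)).smul_const (basisVec i : Param d)
    simpa using this.const_add ξ
  -- Starting the sequence at `n0` keeps every evaluation point in `U`, where measurability is
  -- known.
  obtain ⟨n0, hn0⟩ := eventually_atTop.1 (hlim hU)
  refine measurable_of_tendsto_metrizable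
    (f := fun (n : ℕ) z => ((n + n0 : ℕ) : ℝ) •
      (φ z (ξ + (((n + n0 : ℕ) : ℝ))⁻¹ • basisVec i) - φ z ξ)) (fun n => ?_) ?_
  · simp only [smul_eq_mul]
    exact ((hm _ (hn0 _ (Nat.le_add_left _ _))).sub (hm _ (mem_of_mem_nhds hU))).const_mul _
  · rw [tendsto_pi_nhds]
    intro z
    have := (hd z).lim (basisVec i) (c := fun n : ℕ => ((n + n0 : ℕ) : ℝ)) (l := atTop) (by
      simp only [Real.norm_natCast]
      exact tendsto_natCast_atTop_atTop.comp (tendsto_add_atTop_nat n0))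
    rwa [coordForm_basisVec] at this

/-- Differentiation under the integral sign, in coordinates. -/
lemma hasFDerivAt_integral_coordForm {Q : Measure 𝒳} {φ : 𝒳 → Param d → ℝ}
    {c : 𝒳 → Fin (d + 1) → Param d → ℝ} {U : Set (Param d)} {ξ : Param d} (hU : U ∈ 𝓝 ξ)
    (hm : ∀ ζ ∈ U, Measurable fun z => φ z ζ) (hi : Integrable (fun z => φ z ξ) Q)
    (hd : ∀ z, ∀ ζ ∈ U, HasFDerivAt (φ z) (coordForm fun i => c z i ζ) ζ)
    {b : 𝒳 → ℝ} (hb : Integrable b Q) (hcb : ∀ᵐ z ∂Q, ∀ ζ ∈ U, ∀ i, |c z i ζ| ≤ b z) :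
    HasFDerivAt (fun ζ => ∫ z, φ z ζ ∂Q) (coordForm fun i => ∫ z, c z i ξ ∂Q) ξ := by
  have hcm : ∀ i, Measurable fun z => c z i ξ :=
    measurable_of_hasFDerivAt_coordForm (c := fun z i => c z i ξ) hU hm
      fun z => hd z ξ (mem_of_mem_nhds hU)
  have hci : ∀ i, Integrable (fun z => c z i ξ) Q := fun i =>
    hb.mono' (hcm i).aestronglyMeasurable (by
      filter_upwards [hcb] with z hz using hz ξ (mem_of_mem_nhds hU) i)
  have key := hasFDerivAt_integral_of_dominated_of_fderiv_le (𝕜 := ℝ) (μ := Q)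
    (F := fun ζ z => φ z ζ) (F' := fun ζ z => coordForm fun i => c z i ζ)
    (bound := fun z => (d + 1) * b z) hU
    (eventually_of_mem hU fun ζ hζ => (hm ζ hζ).aestronglyMeasurable) hi ?_ ?_
    (hb.const_mul _) (Eventually.of_forall hd)
  · refine key.congr_fderiv ?_
    unfold coordForm
    rw [integral_finsetSum _ fun i _ => (hci i).smul_const _]
    exact Finset.sum_congr rfl fun i _ => integral_smul_const _ _
  · unfold coordForm
    exact Finset.aestronglyMeasurable_fun_sum _ fun i _ =>
      ((hcm i).aestronglyMeasurable).smul_const _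
  · filter_upwards [hcb] with z hz ζ hζ
    refine (norm_coordForm_le _).trans ((Finset.sum_le_sum fun i _ => hz ζ hζ i).trans ?_)
    simp

end Integral

/-! ### Smooth losses with integrable envelopes. -/

/-- A loss `f z ξ` that is continuous in `ξ ∈ L`, twice continuously differentiable on a ball
about `ξ0`, and dominated there together with its second derivatives. -/
structure SmoothLoss {𝒳 : Type*} [MeasurableSpace 𝒳] {d : ℕ} (Q : Measure 𝒳)
    (f : 𝒳 → Param d → ℝ) (L : Set (Param d)) (ξ0 : Param d) (δ : ℝ) : Prop where
  isCompact : IsCompact L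
  pos : 0 < δ
  ball_subset : Metric.ball ξ0 δ ⊆ L
  measurable : ∀ ξ ∈ L, Measurable fun z => f z ξ
  continuousOn : ∀ z, ContinuousOn (f z) L
  contDiffOn : ∀ z, ContDiffOn ℝ 2 (f z) (Metric.ball ξ0 δ)
  dominated : ∃ b, Integrable b Q ∧ ∀ᵐ z ∂Q, (∀ ξ ∈ L, |f z ξ| ≤ b z) ∧
    ∀ ξ ∈ Metric.ball ξ0 δ, ∀ i j, |partial2 (f z) i j ξ| ≤ b z

namespace SmoothLoss

variable {𝒳 : Type*} [MeasurableSpace 𝒳] {d : ℕ} {Q : Measure 𝒳} {f : 𝒳 → Param d → ℝ}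
  {L : Set (Param d)} {ξ0 : Param d} {δ : ℝ}

lemma contDiffAt (h : SmoothLoss Q f L ξ0 δ) (z : 𝒳) {ξ : Param d} (hξ : ξ ∈ Metric.ball ξ0 δ) :
    ContDiffAt ℝ 2 (f z) ξ :=
  (h.contDiffOn z).contDiffAt (Metric.isOpen_ball.mem_nhds hξ)

lemma closedBall_subset (h : SmoothLoss Q f L ξ0 δ) :
    Metric.closedBall ξ0 (δ / 2) ⊆ Metric.ball ξ0 δ :=
  Metric.closedBall_subset_ball (half_lt_self h.pos)

lemma center_mem (h : SmoothLoss Q f L ξ0 δ) : ξ0 ∈ Metric.ball ξ0 (δ / 2) :=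
  Metric.mem_ball_self (half_pos h.pos)

lemma hasFDerivAt (h : SmoothLoss Q f L ξ0 δ) (z : 𝒳) {ξ : Param d}
    (hξ : ξ ∈ Metric.ball ξ0 δ) :
    HasFDerivAt (f z) (coordForm fun i => partial1 (f z) i ξ) ξ :=
  hasFDerivAt_coordForm ((h.contDiffAt z hξ).differentiableAt two_ne_zero)

lemma hasFDerivAt_partial1 (h : SmoothLoss Q f L ξ0 δ) (z : 𝒳) {ξ : Param d}
    (hξ : ξ ∈ Metric.ball ξ0 δ) (j : Fin (d + 1)) :
    HasFDerivAt (partial1 (f z) j) (coordForm fun i => partial2 (f z) i j ξ) ξ :=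
  NCESetting.hasFDerivAt_partial1 (h.contDiffAt z hξ) j

lemma measurable_partial1 (h : SmoothLoss Q f L ξ0 δ) {ξ : Param d} (hξ : ξ ∈ Metric.ball ξ0 δ)
    (i : Fin (d + 1)) : Measurable fun z => partial1 (f z) i ξ :=
  measurable_of_hasFDerivAt_coordForm (c := fun z i => partial1 (f z) i ξ)
    (Metric.isOpen_ball.mem_nhds hξ) (fun ζ hζ => h.measurable ζ (h.ball_subset hζ))
    (fun z => h.hasFDerivAt z hξ) i

lemma measurable_partial2 (h : SmoothLoss Q f L ξ0 δ) {ξ : Param d} (hξ : ξ ∈ Metric.ball ξ0 δ)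
    (i j : Fin (d + 1)) : Measurable fun z => partial2 (f z) i j ξ :=
  measurable_of_hasFDerivAt_coordForm (c := fun z i => partial2 (f z) i j ξ)
    (Metric.isOpen_ball.mem_nhds hξ) (fun _ hζ => h.measurable_partial1 hζ j)
    (fun z => h.hasFDerivAt_partial1 z hξ j) i

/-- First derivatives have no assumed envelope; `abs_partial1_le` supplies one by interpolation, at
the price of halving the radius. -/
lemma dominated_closedBall (h : SmoothLoss Q f L ξ0 δ) : ∃ b, Integrable b Q ∧ ∀ᵐ z ∂Q,
    (∀ ξ ∈ L, |f z ξ| ≤ b z) ∧ ∀ ξ ∈ Metric.closedBall ξ0 (δ / 2),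
      (∀ i, |partial1 (f z) i ξ| ≤ b z) ∧ ∀ i j, |partial2 (f z) i j ξ| ≤ b z := by
  obtain ⟨b, hb, hbz⟩ := h.dominated
  have hδ := h.pos
  set C := 8 / δ + δ / 4 with hCdef
  have hC : 0 < C := by positivity
  -- The summand `1` covers the given envelope, the summand `C` the interpolated one.
  refine ⟨fun z => (1 + C) * b z, hb.const_mul _, ?_⟩
  filter_upwards [hbz] with z hz
  have hb0 : 0 ≤ b z := (abs_nonneg _).trans (hz.1 ξ0 (h.ball_subset (Metric.mem_ball_self hδ)))
  have hle : b z ≤ (1 + C) * b z := by nlinarith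
  refine ⟨fun ξ hξ => (hz.1 ξ hξ).trans hle, fun ξ hξ => ⟨fun i => ?_, fun i j => ?_⟩⟩
  · refine (abs_partial1_le hδ (h.contDiffOn z) (fun ζ hζ => hz.1 ζ (h.ball_subset hζ)) hz.2
      hξ i).trans ?_
    rw [← hCdef]
    nlinarith
  · exact (hz.2 ξ (h.closedBall_subset hξ) i j).trans hle

lemma integrable (h : SmoothLoss Q f L ξ0 δ) {ξ : Param d} (hξ : ξ ∈ L) :
    Integrable (fun z => f z ξ) Q := by
  obtain ⟨b, hb, hbz⟩ := h.dominated
  exact hb.mono' (h.measurable ξ hξ).aestronglyMeasurable (hbz.mono fun z hz => hz.1 ξ hξ)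

lemma integrable_partial1 (h : SmoothLoss Q f L ξ0 δ) {ξ : Param d}
    (hξ : ξ ∈ Metric.closedBall ξ0 (δ / 2)) (i : Fin (d + 1)) :
    Integrable (fun z => partial1 (f z) i ξ) Q := by
  obtain ⟨b, hb, hbz⟩ := h.dominated_closedBall
  exact hb.mono' (h.measurable_partial1 (h.closedBall_subset hξ) i).aestronglyMeasurable
    (hbz.mono fun z hz => (hz.2 ξ hξ).1 i)

/-- The half-radius ball is where first derivatives are dominated. -/
lemma hasFDerivAt_integral (h : SmoothLoss Q f L ξ0 δ) {ξ : Param d}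
    (hξ : ξ ∈ Metric.ball ξ0 (δ / 2)) :
    HasFDerivAt (fun ζ => ∫ z, f z ζ ∂Q) (coordForm fun i => ∫ z, partial1 (f z) i ξ ∂Q) ξ := by
  obtain ⟨b, hb, hbz⟩ := h.dominated_closedBall
  have hsub : Metric.ball ξ0 (δ / 2) ⊆ Metric.ball ξ0 δ :=
    Metric.ball_subset_closedBall.trans h.closedBall_subset
  exact hasFDerivAt_integral_coordForm (c := fun z i ζ => partial1 (f z) i ζ)
    (Metric.isOpen_ball.mem_nhds hξ) (fun ζ hζ => h.measurable ζ (h.ball_subset (hsub hζ)))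
    (h.integrable (h.ball_subset (hsub hξ))) (fun z ζ hζ => h.hasFDerivAt z (hsub hζ)) hb
    (hbz.mono fun z hz ζ hζ => (hz.2 ζ (Metric.ball_subset_closedBall hζ)).1)

lemma hasFDerivAt_integral_partial1 (h : SmoothLoss Q f L ξ0 δ) {ξ : Param d}
    (hξ : ξ ∈ Metric.ball ξ0 (δ / 2)) (j : Fin (d + 1)) :
    HasFDerivAt (fun ζ => ∫ z, partial1 (f z) j ζ ∂Q)
      (coordForm fun i => ∫ z, partial2 (f z) i j ξ ∂Q) ξ := by
  obtain ⟨b, hb, hbz⟩ := h.dominated_closedBall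
  have hsub : Metric.ball ξ0 (δ / 2) ⊆ Metric.ball ξ0 δ :=
    Metric.ball_subset_closedBall.trans h.closedBall_subset
  exact hasFDerivAt_integral_coordForm (φ := fun z => partial1 (f z) j)
    (c := fun z i ζ => partial2 (f z) i j ζ)
    (Metric.isOpen_ball.mem_nhds hξ) (fun ζ hζ => h.measurable_partial1 (hsub hζ) j)
    (h.integrable_partial1 (Metric.ball_subset_closedBall hξ) j)
    (fun z ζ hζ => h.hasFDerivAt_partial1 z (hsub hζ) j) hb
    (hbz.mono fun z hz ζ hζ i => (hz.2 ζ (Metric.ball_subset_closedBall hζ)).2 i j)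

variable {Ω : Type*} [MeasurableSpace Ω] {P : Measure Ω} [IsProbabilityMeasure P] {X : ℕ → Ω → 𝒳}

lemma ae_tendstoUniformlyOn (h : SmoothLoss Q f L ξ0 δ) (hX : ∀ t, HasLaw (X t) Q P)
    (hind : iIndepFun X P) :
    (∀ᵐ ω ∂P, TendstoUniformlyOn
      (fun (n : ℕ) ξ => (n : ℝ)⁻¹ * ∑ t ∈ Finset.range n, f (X t ω) ξ)
      (fun ξ => ∫ z, f z ξ ∂Q) atTop L) ∧ ContinuousOn (fun ξ => ∫ z, f z ξ ∂Q) L := by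
  obtain ⟨b, hb, hbz⟩ := h.dominated
  exact uniform_strong_law hX hind h.isCompact h.measurable h.continuousOn hb
    (hbz.mono fun z hz => hz.1)

lemma ae_tendstoUniformlyOn_partial2 (h : SmoothLoss Q f L ξ0 δ) (hX : ∀ t, HasLaw (X t) Q P)
    (hind : iIndepFun X P) (i j : Fin (d + 1)) :
    (∀ᵐ ω ∂P, TendstoUniformlyOn
      (fun (n : ℕ) ξ => (n : ℝ)⁻¹ * ∑ t ∈ Finset.range n, partial2 (f (X t ω)) i j ξ)
      (fun ξ => ∫ z, partial2 (f z) i j ξ ∂Q) atTop (Metric.closedBall ξ0 (δ / 2))) ∧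
    ContinuousOn (fun ξ => ∫ z, partial2 (f z) i j ξ ∂Q) (Metric.closedBall ξ0 (δ / 2)) := by
  obtain ⟨b, hb, hbz⟩ := h.dominated_closedBall
  exact uniform_strong_law (φ := fun z => partial2 (f z) i j) hX hind
    (isCompact_closedBall ξ0 (δ / 2))
    (fun ξ hξ => h.measurable_partial2 (h.closedBall_subset hξ) i j)
    (fun z ξ hξ => (continuousAt_partial2 (h.contDiffAt z (h.closedBall_subset hξ))
      i j).continuousWithinAt) hb
    (hbz.mono fun z hz ξ hξ => (hz.2 ξ hξ).2 i j)

end SmoothLoss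

end NCESetting

/-! ### Convergence of powers of characteristic functions. -/

/-- If `m g → t` with `m → ∞` then `(1 + g) ^ m → exp t`. -/
lemma tendsto_one_add_pow_of_tendsto_mul {κ : Type*} {l : Filter κ} {m : κ → ℕ} {g : κ → ℂ} {t : ℂ}
    (hm : Tendsto m l atTop) (hg : Tendsto (fun s => (m s : ℂ) * g s) l (𝓝 t)) :
    Tendsto (fun s => (1 + g s) ^ m s) l (𝓝 (Complex.exp t)) := by
  have hinv : Tendsto (fun s => ((m s : ℂ))⁻¹) l (𝓝 0) :=
    (tendsto_inv_atTop_nhds_zero_nat (𝕜 := ℂ)).comp hm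
  have hm0 : ∀ᶠ s in l, (m s : ℂ) ≠ 0 := by
    filter_upwards [hm.eventually_gt_atTop 0] with s hs
    exact_mod_cast hs.ne'
  have hg0 : Tendsto g l (𝓝 0) := by
    have := hinv.mul hg
    rw [zero_mul] at this
    refine this.congr' ?_
    filter_upwards [hm0] with s hs
    field_simp
  -- Since `log (1 + g) - g = O(g ^ 2)`, the error is `O((m g) g)`, which tends to zero.
  have hrem : Tendsto (fun s => (m s : ℂ) * (Complex.log (1 + g s) - g s)) l (𝓝 0) := by
    have h1 : (fun s => (m s : ℂ) * (Complex.log (1 + g s) - g s)) =O[l]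
        fun s => (m s : ℂ) * g s ^ 2 :=
      (Asymptotics.isBigO_refl _ _).mul (Complex.log_sub_self_isBigO.comp_tendsto hg0)
    refine h1.trans_tendsto ?_
    have := hg.mul hg0
    rw [mul_zero] at this
    exact this.congr fun s => by ring
  have hlog : Tendsto (fun s => (m s : ℂ) * Complex.log (1 + g s)) l (𝓝 t) := by
    have := hg.add hrem
    rw [add_zero] at this
    exact this.congr fun s => by ring
  refine ((Complex.continuous_exp.tendsto t).comp hlog).congr' ?_
  have h1 : Tendsto (fun s => 1 + g s) l (𝓝 1) := by simpa using hg0.const_add 1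
  filter_upwards [h1.eventually_ne one_ne_zero] with s hs
  simp [Complex.exp_nat_mul, Complex.exp_log hs]

/-- Powers of the characteristic function of a centred square integrable random variable, with
exponent proportional to the squared scale, converge to a Gaussian characteristic function. -/
lemma tendsto_charFun_pow {Ω : Type*} [MeasurableSpace Ω] {P : Measure Ω} [IsProbabilityMeasure P]
    {Z : Ω → ℝ} (hZ : MemLp Z 2 P) (h0 : ∫ ω, Z ω ∂P = 0) {n m : ℕ → ℕ}
    (hn : Tendsto n atTop atTop) (hm : Tendsto m atTop atTop) {ν : ℝ}
    (hnm : Tendsto (fun s => (m s : ℝ) / (n s : ℝ)) atTop (𝓝 ν)) :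
    Tendsto (fun s => charFun (P.map Z) ((√(n s : ℝ))⁻¹) ^ m s) atTop
      (𝓝 (Complex.exp (-((ν * ∫ ω, Z ω ^ 2 ∂P : ℝ) : ℂ) / 2))) := by
  have hZm : AEMeasurable Z P := hZ.aestronglyMeasurable.aemeasurable
  have hpr : IsProbabilityMeasure (P.map Z) := Measure.isProbabilityMeasure_map hZm
  have hid : MemLp id 2 (P.map Z) := (memLp_map_measure_iff (by fun_prop) hZm).2 hZ
  set σ := ∫ ω, Z ω ^ 2 ∂P
  -- Square integrability gives a second-order Taylor expansion, and the linear term vanishes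
  -- because `Z` is centred.
  have htaylor : (fun t : ℝ => charFun (P.map Z) t - (1 - (σ : ℂ) * t ^ 2 / 2)) =o[𝓝 0]
      fun t => t ^ 2 := by
    have h1 : (fun t : ℝ => charFun (P.map Z) t
        - taylorWithinEval (charFun (P.map Z)) 2 Set.univ 0 t) =o[𝓝 0] fun t => t ^ 2 := by
      simpa using taylor_isLittleO_univ (f := charFun (P.map Z)) (n := 2) (x₀ := 0)
        (contDiff_charFun hid)
    simp_rw [taylorWithinEval_charFun_two_zero hZm hid, h0] at h1
    simpa using h1
  have hscale : Tendsto (fun s => (√(n s : ℝ))⁻¹) atTop (𝓝 0) :=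
    tendsto_inv_atTop_zero.comp (Real.tendsto_sqrt_atTop.comp
      (tendsto_natCast_atTop_atTop.comp hn))
  have h2 := htaylor.comp_tendsto hscale
  -- At argument `n^(-1/2)` the Taylor remainder is `o(1 / n)`, and `m / n` is bounded.
  have h3 : Tendsto (fun s => (m s : ℂ) * (charFun (P.map Z) ((√(n s : ℝ))⁻¹)
      - (1 - (σ : ℂ) * (((√(n s : ℝ))⁻¹ : ℝ) : ℂ) ^ 2 / 2))) atTop (𝓝 0) := by
    have hO : (fun s => ((m s : ℝ) * ((√(n s : ℝ))⁻¹) ^ 2)) =O[atTop] fun _ => (1 : ℝ) := by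
      refine Tendsto.isBigO_one ℝ (c := ν) (hnm.congr fun s => ?_)
      rw [inv_pow, Real.sq_sqrt (Nat.cast_nonneg _), div_eq_mul_inv]
    have h4 : (fun s => (m s : ℂ) * (charFun (P.map Z) ((√(n s : ℝ))⁻¹)
      - (1 - (σ : ℂ) * (((√(n s : ℝ))⁻¹ : ℝ) : ℂ) ^ 2 / 2))) =o[atTop]
        fun s => ((m s : ℝ) * ((√(n s : ℝ))⁻¹) ^ 2) := by
      refine Asymptotics.IsBigO.mul_isLittleO (Asymptotics.IsBigO.of_bound 1 ?_) h2
      simp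
    exact (Asymptotics.isLittleO_one_iff ℝ).1 (h4.trans_isBigO hO)
  have h5 : Tendsto (fun s => (m s : ℂ) * (charFun (P.map Z) ((√(n s : ℝ))⁻¹) - 1)) atTop
      (𝓝 (-((ν * σ : ℝ) : ℂ) / 2)) := by
    have h6 : Tendsto (fun s => -((((m s : ℝ) / (n s : ℝ) * σ : ℝ) : ℂ)) / 2) atTop
        (𝓝 (-((ν * σ : ℝ) : ℂ) / 2)) :=
      (((Complex.continuous_ofReal.tendsto _).comp (hnm.mul_const σ)).neg).div_const 2
    have := h3.add h6
    rw [zero_add] at this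
    refine this.congr fun s => ?_
    have hsq : (((√(n s : ℝ))⁻¹ : ℝ) : ℂ) ^ 2 = ((n s : ℂ))⁻¹ := by
      rw [← Complex.ofReal_pow, inv_pow, Real.sq_sqrt (Nat.cast_nonneg _)]
      push_cast
      rfl
    rw [hsq]
    push_cast
    ring
  refine (tendsto_one_add_pow_of_tendsto_mul hm h5).congr fun s => ?_
  ring

/-! ### The two-sample central limit theorem. -/

section TwoSample

variable {ι Ω 𝒳 : Type*} [Fintype ι] [MeasurableSpace Ω] [MeasurableSpace 𝒳]

/-- Cramér–Wold reduction: along the ray through `u` the vector characteristic function is that of a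
real projection. -/
lemma charFun_map_comp_smul {P : Measure Ω} {Q : Measure 𝒳} {X : Ω → 𝒳} (hX : HasLaw X Q P)
    {V : 𝒳 → EuclideanSpace ℝ ι} (hV : Measurable V) (u : EuclideanSpace ℝ ι) (r : ℝ) :
    charFun (P.map (V ∘ X)) (r • u) = charFun (Q.map fun z => inner ℝ (V z) u) r := by
  rw [← AEMeasurable.map_map_of_aemeasurable hV.aemeasurable hX.aemeasurable, hX.map_eq,
    charFun_apply, charFun_apply_real, integral_map hV.aemeasurable (by fun_prop),
    integral_map (by fun_prop) (by fun_prop)]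
  simp [inner_smul_right]

lemma memLp_inner {Q : Measure 𝒳} {V : 𝒳 → EuclideanSpace ℝ ι}
    (hV2 : ∀ i, MemLp (fun z => V z i) 2 Q) (u : EuclideanSpace ℝ ι) :
    MemLp (fun z => inner ℝ (V z) u) 2 Q := by
  simp only [PiLp.inner_apply, RCLike.inner_apply, conj_trivial]
  exact memLp_finsetSum _ fun i _ => (hV2 i).const_mul _

/-- The matrix of second moments of a random vector. -/
def secondMoment (Q : Measure 𝒳) (V : 𝒳 → EuclideanSpace ℝ ι) : Matrix ι ι ℝ :=
  Matrix.of fun i j => ∫ z, V z i * V z j ∂Q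

/-- Matches the variance in the one-dimensional limit with the quadratic form in the Gaussian
characteristic function. -/
lemma dotProduct_secondMoment_mulVec {Q : Measure 𝒳} {V : 𝒳 → EuclideanSpace ℝ ι}
    (hV2 : ∀ i, MemLp (fun z => V z i) 2 Q) (u : ι → ℝ) :
    dotProduct u (Matrix.mulVec (secondMoment Q V) u)
      = ∫ z, inner ℝ (V z) (WithLp.toLp 2 u) ^ 2 ∂Q := by
  have hint : ∀ i j, Integrable (fun z => V z i * V z j) Q := fun i j =>
    (hV2 i).integrable_mul (hV2 j)
  have hexp : ∀ z, inner ℝ (V z) (WithLp.toLp 2 u) ^ 2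
      = ∑ i, ∑ j, u i * (V z i * V z j * u j) := fun z => by
    simp only [PiLp.inner_apply, RCLike.inner_apply, conj_trivial, sq, Finset.sum_mul_sum]
    exact Finset.sum_congr rfl fun i _ => Finset.sum_congr rfl fun j _ => by ring
  simp_rw [hexp]
  rw [integral_finsetSum _ fun i _ => integrable_finsetSum _ fun j _ =>
    ((hint i j).mul_const _).const_mul _]
  simp only [dotProduct, Matrix.mulVec, secondMoment, Matrix.of_apply, Finset.mul_sum]
  refine Finset.sum_congr rfl fun i _ => ?_
  rw [integral_finsetSum _ fun j _ => ((hint i j).mul_const _).const_mul _]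
  exact Finset.sum_congr rfl fun j _ => by rw [integral_const_mul, integral_mul_const]

lemma posSemidef_secondMoment {Q : Measure 𝒳} {V : 𝒳 → EuclideanSpace ℝ ι}
    (hV2 : ∀ i, MemLp (fun z => V z i) 2 Q) : (secondMoment Q V).PosSemidef := by
  refine Matrix.PosSemidef.of_dotProduct_mulVec_nonneg ?_ fun u => ?_
  · ext i j
    simp [secondMoment, mul_comm]
  · simp only [star_trivial]
    rw [dotProduct_secondMoment_mulVec hV2]
    exact integral_nonneg fun z => sq_nonneg _

/-- Central limit theorem for the sum of two independent samples of centred random vectors whose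
sizes have a convergent ratio. -/
theorem two_sample_clt [DecidableEq ι] {P : Measure Ω} [IsProbabilityMeasure P] {Q Q' : Measure 𝒳}
    [IsProbabilityMeasure Q] [IsProbabilityMeasure Q'] {X Y : ℕ → Ω → 𝒳}
    (hX : ∀ t, HasLaw (X t) Q P) (hY : ∀ t, HasLaw (Y t) Q' P) (hXY : iIndepFun (Sum.elim X Y) P)
    {N M : ℕ → ℕ} (hN0 : ∀ s, 0 < N s) (hN : Tendsto N atTop atTop) (hM : Tendsto M atTop atTop)
    {ν : ℝ} (hν : 0 < ν) (hNM : Tendsto (fun s => (M s : ℝ) / (N s : ℝ)) atTop (𝓝 ν))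
    {V W : 𝒳 → EuclideanSpace ℝ ι} (hV : Measurable V) (hW : Measurable W)
    (hV2 : ∀ i, MemLp (fun z => V z i) 2 Q) (hW2 : ∀ i, MemLp (fun z => W z i) 2 Q')
    (hV0 : ∀ i, ∫ z, V z i ∂Q = 0) (hW0 : ∀ i, ∫ z, W z i ∂Q' = 0) :
    TendstoInDistribution (fun s ω => (√(N s : ℝ))⁻¹ •
        (∑ t ∈ Finset.range (N s), V (X t ω) + ∑ t ∈ Finset.range (M s), W (Y t ω)))
      atTop id (fun _ => P)
      (multivariateGaussian 0 (secondMoment Q V + ν • secondMoment Q' W)) := by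
  have hVX : ∀ t, AEMeasurable (V ∘ X t) P := fun t => hV.comp_aemeasurable (hX t).aemeasurable
  have hWY : ∀ t, AEMeasurable (W ∘ Y t) P := fun t => hW.comp_aemeasurable (hY t).aemeasurable
  have hS : (secondMoment Q V + ν • secondMoment Q' W).PosSemidef :=
    (posSemidef_secondMoment hV2).add ((posSemidef_secondMoment hW2).smul hν.le)
  have hsum : ∀ n m, AEMeasurable (fun ω => ∑ t ∈ Finset.range n, V (X t ω)
      + ∑ t ∈ Finset.range m, W (Y t ω)) P := fun n m =>
    (Finset.aemeasurable_fun_sum _ fun t _ => hVX t).add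
      (Finset.aemeasurable_fun_sum _ fun t _ => hWY t)
  refine ⟨fun s => (hsum (N s) (M s)).fun_const_smul ((√(N s : ℝ))⁻¹), aemeasurable_id, ?_⟩
  refine ProbabilityMeasure.tendsto_iff_tendsto_charFun.2 fun u => ?_
  -- Joining both samples into one independent family lets the characteristic function of the whole
  -- sum factor at once.
  let A : ℕ ⊕ ℕ → Ω → EuclideanSpace ℝ ι := Sum.elim (fun t => V ∘ X t) (fun t => W ∘ Y t)
  have hA : iIndepFun A P := by
    have := hXY.comp (Sum.elim (fun _ => V) (fun _ => W)) (by rintro (i | i) <;> simpa)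
    convert this using 2 with i
    rcases i with i | i <;> rfl
  have hAm : ∀ i, AEMeasurable (A i) P := by
    rintro (i | i)
    exacts [hVX i, hWY i]
  have hprod : ∀ s, charFun (P.map fun ω => (√(N s : ℝ))⁻¹ •
        (∑ t ∈ Finset.range (N s), V (X t ω) + ∑ t ∈ Finset.range (M s), W (Y t ω))) u
      = charFun (Q.map fun z => inner ℝ (V z) u) ((√(N s : ℝ))⁻¹) ^ N s
        * charFun (Q'.map fun z => inner ℝ (W z) u) ((√(N s : ℝ))⁻¹) ^ M s := fun s => by
    rw [charFun_map_smul_comp (hsum _ _)]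
    have hs : (fun ω => ∑ t ∈ Finset.range (N s), V (X t ω) + ∑ t ∈ Finset.range (M s), W (Y t ω))
        = fun ω => ∑ i ∈ (Finset.range (N s)).disjSum (Finset.range (M s)), A i ω := by
      ext1 ω
      rw [Finset.sum_disjSum]
      rfl
    rw [hs, (hA.restrict _).charFun_map_fun_finsetSum_eq_prod fun i _ => hAm i,
      Finset.prod_disjSum]
    simp only [Pi.mul_apply, Finset.prod_apply]
    have h1 : ∀ t, charFun (P.map (A (Sum.inl t))) ((√(N s : ℝ))⁻¹ • u)
        = charFun (Q.map fun z => inner ℝ (V z) u) ((√(N s : ℝ))⁻¹) :=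
      fun t => charFun_map_comp_smul (hX t) hV u _
    have h2 : ∀ t, charFun (P.map (A (Sum.inr t))) ((√(N s : ℝ))⁻¹ • u)
        = charFun (Q'.map fun z => inner ℝ (W z) u) ((√(N s : ℝ))⁻¹) :=
      fun t => charFun_map_comp_smul (hY t) hW u _
    simp [h1, h2]
  have hmean : ∀ {S : Measure 𝒳} [IsProbabilityMeasure S] {U : 𝒳 → EuclideanSpace ℝ ι},
      (∀ i, MemLp (fun z => U z i) 2 S) → (∀ i, ∫ z, U z i ∂S = 0) →
      ∫ z, inner ℝ (U z) u ∂S = 0 := fun hU hU0 => by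
    simp only [PiLp.inner_apply, RCLike.inner_apply, conj_trivial]
    rw [integral_finsetSum _ fun i _ => ((hU i).integrable one_le_two).const_mul _]
    simp [integral_const_mul, hU0]
  -- The first sample is the case of ratio `1`: exponent and squared scale agree.
  have hNN : Tendsto (fun s => (N s : ℝ) / (N s : ℝ)) atTop (𝓝 1) :=
    tendsto_const_nhds.congr fun s => (div_self (Nat.cast_ne_zero.2 (hN0 s).ne')).symm
  have hlimV := tendsto_charFun_pow (memLp_inner hV2 u) (hmean hV2 hV0) hN hN hNN
  have hlimW := tendsto_charFun_pow (memLp_inner hW2 u) (hmean hW2 hW0) hN hM hNM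
  have hlim := hlimV.mul hlimW
  simp only [ProbabilityMeasure.coe_mk, Measure.map_id]
  simp_rw [hprod]
  convert hlim using 2
  rw [charFun_multivariateGaussian hS, ← Complex.exp_add]
  congr 1
  rw [Matrix.add_mulVec, Matrix.smul_mulVec, dotProduct_add, dotProduct_smul,
    dotProduct_secondMoment_mulVec hV2, dotProduct_secondMoment_mulVec hW2]
  simp
  ring

end TwoSample

/-! ### Slutsky arguments. -/

section Slutsky

variable {Ω Ω' E : Type*} [MeasurableSpace Ω] [MeasurableSpace Ω'] [NormedAddCommGroup E]
  [NormedSpace ℝ E] [SecondCountableTopology E] [MeasurableSpace E] [BorelSpace E]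
  {P : Measure Ω} [IsProbabilityMeasure P] {P' : Measure Ω'} [IsProbabilityMeasure P']

/-- A perturbation that is almost surely negligible relative to `1 + ‖T‖` does not affect the limit
in distribution of `T`. -/
lemma tendstoInDistribution_of_sub_isLittleO {T Z : ℕ → Ω → E} {G : Ω' → E}
    (hT : TendstoInDistribution T atTop G (fun _ => P) P') (hZ : ∀ s, AEMeasurable (Z s) P)
    (hTZ : ∀ᵐ ω ∂P, (fun s => Z s ω - T s ω) =o[atTop] fun s => 1 + ‖T s ω‖) :
    TendstoInDistribution Z atTop G (fun _ => P) P' := by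
  have hTm := hT.forall_aemeasurable
  -- The relative error `q` tends to zero in probability, and `Z = T + (1 + ‖T‖) q` is a continuous
  -- function of `(T, q)`. No separate tightness argument for `T` is needed.
  set q : ℕ → Ω → E := fun s ω => (1 + ‖T s ω‖)⁻¹ • (Z s ω - T s ω) with hq
  have hqm : ∀ s, AEMeasurable (q s) P := fun s =>
    ((hTm s).norm.const_add 1).inv.smul ((hZ s).sub (hTm s))
  have hq0 : TendstoInMeasure P q atTop fun _ => 0 := by
    refine tendstoInMeasure_of_tendsto_ae (fun s => (hqm s).aestronglyMeasurable) ?_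
    filter_upwards [hTZ] with ω hω using hω.tendsto_inv_smul_nhds_zero
  have key := hT.continuous_comp_prodMk_of_tendstoInMeasure_const
    (g := fun x : E × E => x.1 + (1 + ‖x.1‖) • x.2) (by fun_prop) hq0 hqm
  simp only [smul_zero, add_zero] at key
  refine key.congr (fun s => ae_of_all _ fun ω => ?_) (ae_of_all _ fun _ => rfl)
  have : 1 + ‖T s ω‖ ≠ 0 := by positivity
  simp [hq, smul_smul, mul_inv_cancel₀ this]

/-- Slutsky's theorem for multiplication by a convergent deterministic sequence. -/
lemma TendstoInDistribution.smul_tendsto {Z : ℕ → Ω → E} {G : Ω' → E}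
    (hZ : TendstoInDistribution Z atTop G (fun _ => P) P') {c : ℕ → ℝ} {c0 : ℝ}
    (hc : Tendsto c atTop (𝓝 c0)) :
    TendstoInDistribution (fun s ω => c s • Z s ω) atTop (fun ω => c0 • G ω) (fun _ => P) P' :=
  hZ.continuous_comp_prodMk_of_tendstoInMeasure_const (Y := fun s _ => c s) (c := c0)
    (g := fun x : E × ℝ => x.2 • x.1) (by fun_prop)
    (tendstoInMeasure_of_tendsto_ae (fun s => aestronglyMeasurable_const) (ae_of_all _ fun _ => hc))
    (fun s => aemeasurable_const)

end Slutsky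

/-! ### Linear images of Gaussian laws. -/

section MultivariateGaussian

variable {ι : Type*} [Fintype ι] [DecidableEq ι]

/-- Linear images of centred multivariate Gaussian distributions. -/
lemma map_multivariateGaussian {S A : Matrix ι ι ℝ} (hS : S.PosSemidef) :
    (multivariateGaussian 0 S).map (Matrix.toEuclideanCLM (𝕜 := ℝ) A)
      = multivariateGaussian 0 (A * S * A.transpose) := by
  have hS' : (A * S * A.transpose).PosSemidef := by
    simpa using hS.mul_mul_conjTranspose_same A
  have : IsProbabilityMeasure ((multivariateGaussian 0 S).map (Matrix.toEuclideanCLM (𝕜 := ℝ) A)) :=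
    Measure.isProbabilityMeasure_map (by fun_prop)
  refine Measure.ext_of_charFun (funext fun t => ?_)
  -- In the inner product the matrix passes to the other side as its transpose.
  have h1 : charFun ((multivariateGaussian 0 S).map (Matrix.toEuclideanCLM (𝕜 := ℝ) A)) t
      = charFun (multivariateGaussian 0 S) (Matrix.toEuclideanCLM (𝕜 := ℝ) A.transpose t) := by
    rw [charFun_apply, charFun_apply, integral_map (by fun_prop) (by fun_prop)]
    congr 1
    ext x
    congr 3
    simp only [EuclideanSpace.inner_eq_star_dotProduct, star_trivial,
      Matrix.ofLp_toEuclideanCLM]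
    rw [Matrix.dotProduct_mulVec, Matrix.mulVec_transpose]
  rw [h1, charFun_multivariateGaussian hS, charFun_multivariateGaussian hS']
  simp only [inner_zero_right, Matrix.ofLp_toEuclideanCLM]
  congr 3
  rw [← Matrix.mulVec_mulVec, ← Matrix.mulVec_mulVec, Matrix.dotProduct_mulVec _ A,
    Matrix.mulVec_transpose]

/-- The limit in distribution may be replaced by the identity under its law. -/
lemma TendstoInDistribution.id_of_map_eq {Ω Ω' E : Type*} [MeasurableSpace Ω] [MeasurableSpace Ω']
    [NormedAddCommGroup E] [MeasurableSpace E] [BorelSpace E]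
    {P : Measure Ω} [IsProbabilityMeasure P] {P' : Measure Ω'} [IsProbabilityMeasure P']
    {Z : ℕ → Ω → E} {G : Ω' → E} (hZ : TendstoInDistribution Z atTop G (fun _ => P) P')
    {ρ : Measure E} [IsProbabilityMeasure ρ] (hρ : P'.map G = ρ) :
    TendstoInDistribution Z atTop id (fun _ => P) ρ := by
  refine ⟨hZ.forall_aemeasurable, aemeasurable_id, ?_⟩
  have h : (⟨P'.map G, Measure.isProbabilityMeasure_map hZ.aemeasurable_limit⟩ :
      ProbabilityMeasure E) = ⟨ρ.map id, Measure.isProbabilityMeasure_map aemeasurable_id⟩ :=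
    Subtype.ext (hρ.trans Measure.map_id.symm)
  have := hZ.tendsto
  rwa [h] at this

end MultivariateGaussian

/-! ### Mean-square convergence and Chebyshev bounds. -/

section SecondMoments

variable {Ω 𝒳 : Type*} [MeasurableSpace Ω] [MeasurableSpace 𝒳]

/-- Pointwise convergence together with convergence of the second moments gives convergence in
mean square. -/
lemma tendsto_integral_sq_sub {Q : Measure 𝒳} {V : ℕ → 𝒳 → ℝ} {V0 : 𝒳 → ℝ}
    (hV : ∀ s, MemLp (V s) 2 Q) (hV0 : MemLp V0 2 Q)
    (hlim : ∀ᵐ z ∂Q, Tendsto (fun s => V s z) atTop (𝓝 (V0 z)))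
    (hsq : Tendsto (fun s => ∫ z, V s z ^ 2 ∂Q) atTop (𝓝 (∫ z, V0 z ^ 2 ∂Q))) :
    Tendsto (fun s => ∫ z, (V s z - V0 z) ^ 2 ∂Q) atTop (𝓝 0) := by
  have hadd : ∀ s, Integrable (fun z => (V s z + V0 z) ^ 2) Q := fun s =>
    ((hV s).add hV0).integrable_sq
  have hi : ∀ s, Integrable (fun z => V s z ^ 2) Q := fun s => (hV s).integrable_sq
  have hi0 : Integrable (fun z => V0 z ^ 2) Q := hV0.integrable_sq
  -- Parallelogram law: an upper bound on the distance follows from a lower bound on the moment of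
  -- the sum.
  have hpar : ∀ s, ∫ z, (V s z - V0 z) ^ 2 ∂Q
      = 2 * ∫ z, V s z ^ 2 ∂Q + 2 * ∫ z, V0 z ^ 2 ∂Q - ∫ z, (V s z + V0 z) ^ 2 ∂Q := fun s => by
    have h2 : Integrable (fun z => 2 * V s z ^ 2 + 2 * V0 z ^ 2) Q :=
      ((hi s).const_mul 2).add (hi0.const_mul 2)
    rw [← integral_const_mul, ← integral_const_mul,
      ← integral_add ((hi s).const_mul 2) (hi0.const_mul 2), ← integral_sub h2 (hadd s)]
    congr 1
    ext z
    ring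
  set B := ∫ z, V0 z ^ 2 ∂Q
  -- Fatou's lemma gives the lower bound, as `(V s + V0) ^ 2` tends pointwise to `4 * V0 ^ 2`. A
  -- negative threshold is treated apart because `ENNReal.ofReal` truncates.
  have hfatou : ∀ ε > 0, ∀ᶠ s in atTop, 4 * B - ε < ∫ z, (V s z + V0 z) ^ 2 ∂Q := by
    intro ε hε
    rcases lt_or_ge (4 * B - ε) 0 with hneg | hpos
    · exact Eventually.of_forall fun s => hneg.trans_le (integral_nonneg fun z => sq_nonneg _)
    have h1 := lintegral_liminf_le' (μ := Q) (u := atTop)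
      (f := fun s z => ENNReal.ofReal ((V s z + V0 z) ^ 2))
      fun s => (hadd s).aestronglyMeasurable.aemeasurable.ennreal_ofReal
    have h2 : ∫⁻ z, liminf (fun s => ENNReal.ofReal ((V s z + V0 z) ^ 2)) atTop ∂Q
        = ENNReal.ofReal (4 * B) := by
      have : ∀ᵐ z ∂Q, liminf (fun s => ENNReal.ofReal ((V s z + V0 z) ^ 2)) atTop
          = ENNReal.ofReal (4 * V0 z ^ 2) := by
        filter_upwards [hlim] with z hz
        have : Tendsto (fun s => (V s z + V0 z) ^ 2) atTop (𝓝 (4 * V0 z ^ 2)) := by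
          have := (hz.add_const (V0 z)).pow 2
          convert this using 2
          ring
        exact (ENNReal.tendsto_ofReal this).liminf_eq
      rw [lintegral_congr_ae this, ← ofReal_integral_eq_lintegral_ofReal (hi0.const_mul 4)
        (ae_of_all _ fun z => by positivity), integral_const_mul]
    rw [h2] at h1
    have h3 : ENNReal.ofReal (4 * B - ε) < ENNReal.ofReal (4 * B) :=
      (ENNReal.ofReal_lt_ofReal_iff_of_nonneg hpos).2 (by linarith)
    filter_upwards [eventually_lt_of_lt_liminf (h3.trans_le h1)] with s hs
    rw [← ofReal_integral_eq_lintegral_ofReal (hadd s) (ae_of_all _ fun z => sq_nonneg _)] at hs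
    exact (ENNReal.ofReal_lt_ofReal_iff_of_nonneg hpos).1 hs
  rw [Metric.tendsto_nhds]
  intro ε hε
  filter_upwards [hfatou (ε / 2) (half_pos hε),
    Metric.tendsto_nhds.1 hsq (ε / 4) (by positivity)] with s h1 h2
  rw [Real.dist_eq, abs_lt] at h2
  rw [dist_zero_right, Real.norm_of_nonneg (integral_nonneg fun z => sq_nonneg _), hpar s]
  linarith [h2.2]

lemma tendstoInMeasure_zero_of_norm_le_sum {κ E : Type*} [Fintype κ] [NormedAddCommGroup E]
    {P : Measure Ω} {A : κ → ℕ → Ω → ℝ} (hA : ∀ k, TendstoInMeasure P (A k) atTop 0)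
    {R : ℕ → Ω → E} (hR : ∀ s ω, ‖R s ω‖ ≤ ∑ k, |A k s ω|) :
    TendstoInMeasure P R atTop 0 := by
  rw [tendstoInMeasure_iff_norm]
  intro ε hε
  -- The extra `1` keeps the denominator positive and makes the total strictly smaller than `ε`.
  set η := ε / (Fintype.card κ + 1) with hη
  have hη0 : 0 < η := by positivity
  have hsum : Tendsto (fun s => ∑ k, P {ω | η ≤ ‖A k s ω - (0 : Ω → ℝ) ω‖}) atTop (𝓝 0) := by
    have := tendsto_finsetSum (Finset.univ : Finset κ)
      fun k _ => (tendstoInMeasure_iff_norm.1 (hA k)) η hη0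
    simpa using this
  refine tendsto_of_tendsto_of_tendsto_of_le_of_le tendsto_const_nhds hsum (fun s => zero_le)
    fun s => ?_
  refine (measure_mono fun ω hω => ?_).trans
    (measure_iUnion_fintype_le P fun k => {ω | η ≤ ‖A k s ω - (0 : Ω → ℝ) ω‖})
  by_contra hcon
  simp only [Set.mem_iUnion, Set.mem_ofPred_eq, not_exists, not_le, Pi.zero_apply, sub_zero,
    Real.norm_eq_abs] at hcon hω
  have h1 : ∑ k, |A k s ω| ≤ Fintype.card κ * η := by
    refine (Finset.sum_le_sum fun k _ => (hcon k).le).trans (le_of_eq ?_)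
    simp
  have h2 : (Fintype.card κ : ℝ) * η < ε := by
    have : ε = (Fintype.card κ + 1) * η := by rw [hη]; field_simp
    linarith
  linarith [hR s ω]

/-- Normalized sums of independent centred terms vanish in probability if the second moments of
the terms do. -/
lemma tendstoInMeasure_normalized_sum {P : Measure Ω} [IsProbabilityMeasure P] {Q : Measure 𝒳}
    [IsProbabilityMeasure Q] {X : ℕ → Ω → 𝒳} (hX : ∀ t, HasLaw (X t) Q P) (hind : iIndepFun X P)
    {n m : ℕ → ℕ} {ν : ℝ} (hnm : Tendsto (fun s => (m s : ℝ) / (n s : ℝ)) atTop (𝓝 ν))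
    {U : ℕ → 𝒳 → ℝ} (hUm : ∀ s, Measurable (U s)) (hU : ∀ s, MemLp (U s) 2 Q)
    (hU0 : Tendsto (fun s => ∫ z, U s z ^ 2 ∂Q) atTop (𝓝 0)) :
    TendstoInMeasure P (fun s ω => (√(n s : ℝ))⁻¹ *
      ∑ t ∈ Finset.range (m s), (U s (X t ω) - ∫ z, U s z ∂Q)) atTop 0 := by
  rw [tendstoInMeasure_iff_norm]
  intro ε hε
  have hMem : ∀ s t, MemLp (U s ∘ X t) 2 P := fun s t =>
    (memLp_map_measure_iff (by rw [(hX t).map_eq]; exact (hUm s).aestronglyMeasurable)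
      (hX t).aemeasurable).1 (by rw [(hX t).map_eq]; exact hU s)
  have hbound : ∀ s, P {ω | ε ≤ ‖(√(n s : ℝ))⁻¹ * ∑ t ∈ Finset.range (m s),
      (U s (X t ω) - ∫ z, U s z ∂Q) - (0 : Ω → ℝ) ω‖}
      ≤ ENNReal.ofReal (((m s : ℝ) / (n s : ℝ) * ∫ z, U s z ^ 2 ∂Q) / ε ^ 2) := by
    intro s
    set T : Ω → ℝ := fun ω => (√(n s : ℝ))⁻¹ * ∑ t ∈ Finset.range (m s), U s (X t ω) with hT
    have hTm : MemLp T 2 P := (memLp_finsetSum _ fun t _ => hMem s t).const_mul _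
    have hint : ∀ t, ∫ ω, U s (X t ω) ∂P = ∫ z, U s z ∂Q := fun t =>
      (hX t).integral_comp (hUm s).aestronglyMeasurable
    have hmean : P[T] = (√(n s : ℝ))⁻¹ * ∑ t ∈ Finset.range (m s), ∫ z, U s z ∂Q := by
      have hi : ∀ t ∈ Finset.range (m s), Integrable (fun ω => U s (X t ω)) P := fun t _ =>
        (hMem s t).integrable one_le_two
      rw [hT, integral_const_mul, integral_finsetSum _ hi]
      simp_rw [hint]
    -- Pairwise independence makes variances add, and each is at most the raw second moment.
    have hvar : variance T P ≤ (m s : ℝ) / (n s : ℝ) * ∫ z, U s z ^ 2 ∂Q := by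
      have h1 : variance (∑ t ∈ Finset.range (m s), U s ∘ X t) P
          = ∑ t ∈ Finset.range (m s), variance (U s ∘ X t) P :=
        IndepFun.variance_sum (fun t _ => hMem s t) fun i _ j _ hij =>
          (hind.indepFun hij).comp (hUm s) (hUm s)
      have h2 : ∀ t, variance (U s ∘ X t) P ≤ ∫ z, U s z ^ 2 ∂Q := fun t => by
        refine (variance_le_expectation_sq (hMem s t).aestronglyMeasurable).trans (le_of_eq ?_)
        exact (hX t).integral_comp (f := fun z => U s z ^ 2)
          ((hUm s).pow_const 2).aestronglyMeasurable
      have h3 : T = fun ω => (√(n s : ℝ))⁻¹ * (∑ t ∈ Finset.range (m s), U s ∘ X t) ω := by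
        ext ω
        simp [hT]
      rw [h3, variance_const_mul, h1, inv_pow, Real.sq_sqrt (Nat.cast_nonneg _)]
      calc ((n s : ℝ))⁻¹ * ∑ t ∈ Finset.range (m s), variance (U s ∘ X t) P
          ≤ ((n s : ℝ))⁻¹ * ∑ t ∈ Finset.range (m s), ∫ z, U s z ^ 2 ∂Q := by
            gcongr with t _
            exact h2 t
        _ = _ := by
            rw [Finset.sum_const, Finset.card_range, nsmul_eq_mul]
            ring
    have hset : {ω | ε ≤ ‖(√(n s : ℝ))⁻¹ * ∑ t ∈ Finset.range (m s),
        (U s (X t ω) - ∫ z, U s z ∂Q) - (0 : Ω → ℝ) ω‖} = {ω | ε ≤ |T ω - P[T]|} := by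
      ext ω
      rw [Set.mem_ofPred_eq, Set.mem_ofPred_eq, hmean]
      simp only [Pi.zero_apply, sub_zero, Real.norm_eq_abs, hT, Finset.sum_sub_distrib, mul_sub]
    rw [hset]
    refine (meas_ge_le_variance_div_sq hTm hε).trans (ENNReal.ofReal_le_ofReal ?_)
    gcongr
  refine tendsto_of_tendsto_of_tendsto_of_le_of_le tendsto_const_nhds ?_ (fun s => zero_le) hbound
  have := ENNReal.tendsto_ofReal ((hnm.mul hU0).div_const (ε ^ 2))
  simpa using this

end SecondMoments

namespace NCESetting

/-! ### Two-sample averages and uniform limits with varying weights. -/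

section TwoSampleAverage

variable {𝒳 : Type*} {d : ℕ}

/-- The sum of a function over the first sample and another one over the second sample, both
divided by the size of the first sample. -/
def twoSampleAvg (N M : ℕ) (x y : ℕ → 𝒳) (φ ψ : 𝒳 → ℝ) : ℝ :=
  (N : ℝ)⁻¹ * ∑ t ∈ Finset.range N, φ (x t) + (N : ℝ)⁻¹ * ∑ t ∈ Finset.range M, ψ (y t)

lemma hasFDerivAt_twoSampleAvg (N M : ℕ) (x y : ℕ → 𝒳) {φ ψ : 𝒳 → Param d → ℝ}
    {c c' : 𝒳 → Fin (d + 1) → ℝ} {ξ : Param d} (hφ : ∀ z, HasFDerivAt (φ z) (coordForm (c z)) ξ)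
    (hψ : ∀ z, HasFDerivAt (ψ z) (coordForm (c' z)) ξ) :
    HasFDerivAt (fun ζ => twoSampleAvg N M x y (fun z => φ z ζ) (fun z => ψ z ζ))
      (coordForm fun i => twoSampleAvg N M x y (fun z => c z i) (fun z => c' z i)) ξ := by
  have h1 := (HasFDerivAt.fun_sum (u := Finset.range N) fun t _ => hφ (x t)).const_mul (N : ℝ)⁻¹
  have h2 := (HasFDerivAt.fun_sum (u := Finset.range M) fun t _ => hψ (y t)).const_mul (N : ℝ)⁻¹
  refine (h1.add h2).congr_fderiv ?_
  rw [coordForm_sum, coordForm_sum, coordForm_smul, coordForm_smul, coordForm_add]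
  rfl

lemma hasFDerivAt_add_mul {F G : Param d → ℝ} {c c' : Fin (d + 1) → ℝ} {ξ : Param d} (r : ℝ)
    (hF : HasFDerivAt F (coordForm c) ξ) (hG : HasFDerivAt G (coordForm c') ξ) :
    HasFDerivAt (fun ζ => F ζ + r * G ζ) (coordForm fun i => c i + r * c' i) ξ := by
  refine (hF.add (hG.const_mul r)).congr_fderiv ?_
  rw [coordForm_smul, coordForm_add]

/-- The partial derivatives vanish at an interior minimizer. -/
lemma coeff_eq_zero_of_isMinOn {D : Param d → ℝ} {K : Set (Param d)} {a x : Param d}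
    {c : Fin (d + 1) → ℝ} (hmin : IsMinOn (fun ξ => D (ξ - a)) K x) (hx : x ∈ interior K)
    (hD : HasFDerivAt D (coordForm c) (x - a)) (i : Fin (d + 1)) : c i = 0 := by
  have hloc : IsLocalMin (fun ξ => D (ξ - a)) x := hmin.isLocalMin (mem_interior_iff_mem_nhds.1 hx)
  have h0 := hloc.hasFDerivAt_eq_zero ((hasFDerivAt_comp_sub a).2 hD)
  rw [← coordForm_basisVec c i, h0]
  rfl

end TwoSampleAverage

/-- Boundedness of `G` is what makes the change of weight uniformly negligible. -/
lemma tendstoUniformlyOn_add_mul {E : Type*} {B : Set E} {F G : E → ℝ} {u v : ℕ → E → ℝ}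
    {r : ℕ → ℝ} {ν C : ℝ} (hu : TendstoUniformlyOn u F atTop B)
    (hv : TendstoUniformlyOn v G atTop B) (hr : Tendsto r atTop (𝓝 ν)) (hG : ∀ ξ ∈ B, |G ξ| ≤ C) :
    TendstoUniformlyOn (fun s ξ => u s ξ + r s * v s ξ) (fun ξ => F ξ + ν * G ξ) atTop B := by
  rcases B.eq_empty_or_nonempty with rfl | ⟨ξ1, hξ1⟩
  · exact tendstoUniformlyOn_empty
  have hC : 0 ≤ C := (abs_nonneg _).trans (hG ξ1 hξ1)
  rw [Metric.tendstoUniformlyOn_iff] at hu hv ⊢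
  intro ε hε
  have hbd : ∀ᶠ s in atTop, |r s| ≤ |ν| + 1 := by
    filter_upwards [hr.abs.eventually_lt_const (lt_add_one |ν|)] with s hs using hs.le
  filter_upwards [hu (ε / 3) (by positivity), hv (ε / (3 * (|ν| + 1))) (by positivity), hbd,
    Metric.tendsto_nhds.1 hr (ε / (3 * (C + 1))) (by positivity)] with s h1 h2 h3 h4 ξ hξ
  have e1 := h1 ξ hξ
  have e2 := h2 ξ hξ
  rw [Real.dist_eq] at e1 e2 h4 ⊢
  have e3 : |r s * (G ξ - v s ξ)| ≤ ε / 3 := by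
    rw [abs_mul]
    calc |r s| * |G ξ - v s ξ| ≤ (|ν| + 1) * (ε / (3 * (|ν| + 1))) := by gcongr
      _ = ε / 3 := by field_simp
  have e4 : |(r s - ν) * G ξ| < ε / 3 := by
    rw [abs_mul]
    calc |r s - ν| * |G ξ| ≤ |r s - ν| * C := by gcongr; exact hG ξ hξ
      _ ≤ |r s - ν| * (C + 1) := by gcongr; linarith
      _ < ε / (3 * (C + 1)) * (C + 1) := by gcongr
      _ = ε / 3 := by field_simp
  have hdec : F ξ + ν * G ξ - (u s ξ + r s * v s ξ)
      = (F ξ - u s ξ) + r s * (G ξ - v s ξ) - (r s - ν) * G ξ := by ring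
  rw [hdec]
  have t1 := abs_sub (F ξ - u s ξ + r s * (G ξ - v s ξ)) ((r s - ν) * G ξ)
  have t2 := abs_add_le (F ξ - u s ξ) (r s * (G ξ - v s ξ))
  linarith

/-- Two independent samples whose sizes grow with a convergent ratio. -/
structure TwoSample {Ω 𝒳 : Type*} [MeasurableSpace Ω] [MeasurableSpace 𝒳] (P : Measure Ω)
    (Q Q' : Measure 𝒳) (X Y : ℕ → Ω → 𝒳) (N M : ℕ → ℕ) (ν : ℝ) : Prop where
  hasLaw_left : ∀ t, HasLaw (X t) Q P
  hasLaw_right : ∀ t, HasLaw (Y t) Q' P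
  indep : iIndepFun (Sum.elim X Y) P
  left_pos : ∀ s, 0 < N s
  right_pos : ∀ s, 0 < M s
  tendsto_left : Tendsto N atTop atTop
  tendsto_right : Tendsto M atTop atTop
  pos : 0 < ν
  tendsto_ratio : Tendsto (fun s => (M s : ℝ) / (N s : ℝ)) atTop (𝓝 ν)

/-! ### Score and Hessian of two-sample criteria. -/

section Limit

variable {Ω 𝒳 : Type*} [MeasurableSpace Ω] [MeasurableSpace 𝒳] {d : ℕ} {P : Measure Ω}
  {Q Q' : Measure 𝒳} {X Y : ℕ → Ω → 𝒳} {N M : ℕ → ℕ} {ν : ℝ} {f g : 𝒳 → Param d → ℝ} {L : Set (Param d)}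
  {ξ0 : Param d} {δ : ℝ}

namespace TwoSample

lemma indep_left (h : TwoSample P Q Q' X Y N M ν) : iIndepFun X P :=
  h.indep.precomp (g := Sum.inl) Sum.inl_injective

lemma indep_right (h : TwoSample P Q Q' X Y N M ν) : iIndepFun Y P :=
  h.indep.precomp (g := Sum.inr) Sum.inr_injective

lemma twoSampleAvg_eq (h : TwoSample P Q Q' X Y N M ν) (s : ℕ) (x y : ℕ → 𝒳) (φ ψ : 𝒳 → ℝ) :
    twoSampleAvg (N s) (M s) x y φ ψ = (N s : ℝ)⁻¹ * ∑ t ∈ Finset.range (N s), φ (x t)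
      + (M s : ℝ) / (N s : ℝ) * ((M s : ℝ)⁻¹ * ∑ t ∈ Finset.range (M s), ψ (y t)) := by
  have : (M s : ℝ) ≠ 0 := Nat.cast_ne_zero.2 (h.right_pos s).ne'
  rw [twoSampleAvg]
  field_simp

lemma tendstoUniformlyOn_twoSampleAvg (h : TwoSample P Q Q' X Y N M ν) {x y : ℕ → 𝒳}
    {φ ψ : 𝒳 → Param d → ℝ} {B : Set (Param d)} (hB : IsCompact B) {F G : Param d → ℝ}
    (hF : TendstoUniformlyOn (fun (n : ℕ) ξ => (n : ℝ)⁻¹ * ∑ t ∈ Finset.range n, φ (x t) ξ)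
      F atTop B)
    (hG : TendstoUniformlyOn (fun (n : ℕ) ξ => (n : ℝ)⁻¹ * ∑ t ∈ Finset.range n, ψ (y t) ξ)
      G atTop B) (hGc : ContinuousOn G B) :
    TendstoUniformlyOn (fun s ξ => twoSampleAvg (N s) (M s) x y (fun z => φ z ξ) fun z => ψ z ξ)
      (fun ξ => F ξ + ν * G ξ) atTop B := by
  obtain ⟨C, hC⟩ := hB.exists_bound_of_continuousOn hGc
  have h1 : TendstoUniformlyOn
      (fun s ξ => (N s : ℝ)⁻¹ * ∑ t ∈ Finset.range (N s), φ (x t) ξ) F atTop B :=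
    fun U hU => h.tendsto_left.eventually (hF U hU)
  have h2 : TendstoUniformlyOn
      (fun s ξ => (M s : ℝ)⁻¹ * ∑ t ∈ Finset.range (M s), ψ (y t) ξ) G atTop B :=
    fun U hU => h.tendsto_right.eventually (hG U hU)
  refine (tendstoUniformlyOn_add_mul h1 h2 h.tendsto_ratio hC).congr ?_
  exact Eventually.of_forall fun s ξ _ =>
    (h.twoSampleAvg_eq s x y (fun z => φ z ξ) fun z => ψ z ξ).symm

lemma sqrt_pos (h : TwoSample P Q Q' X Y N M ν) (s : ℕ) : 0 < √(N s : ℝ) :=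
  Real.sqrt_pos.2 (Nat.cast_pos.2 (h.left_pos s))

end TwoSample

/-- The centred gradient of a loss. -/
def centeredGrad (Q : Measure 𝒳) (f : 𝒳 → Param d → ℝ) (ξ : Param d) (z : 𝒳) : Param d :=
  WithLp.toLp 2 fun i => partial1 (f z) i ξ - ∫ z', partial1 (f z') i ξ ∂Q

/-- The normalized centred score of two samples. -/
def centeredScore (Q Q' : Measure 𝒳) (f g : 𝒳 → Param d → ℝ) (N M : ℕ) (x y : ℕ → 𝒳)
    (ξ : Param d) : Param d :=
  (√(N : ℝ))⁻¹ • (∑ t ∈ Finset.range N, centeredGrad Q f ξ (x t)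
    + ∑ t ∈ Finset.range M, centeredGrad Q' g ξ (y t))

/-- The centring carries the actual weight `M / N`, since the noise mean is subtracted `M` times. At
a critical point of the expected criterion it vanishes, so the score there is `√N` times the plain
empirical gradient. -/
lemma centeredScore_apply (Q Q' : Measure 𝒳) (f g : 𝒳 → Param d → ℝ) {N : ℕ} (hN : 0 < N) (M : ℕ)
    (x y : ℕ → 𝒳) (ξ : Param d) (i : Fin (d + 1)) :
    centeredScore Q Q' f g N M x y ξ i = √(N : ℝ) *
      (twoSampleAvg N M x y (fun z => partial1 (f z) i ξ) (fun z => partial1 (g z) i ξ)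
        - (∫ z, partial1 (f z) i ξ ∂Q + (M : ℝ) / N * ∫ z, partial1 (g z) i ξ ∂Q')) := by
  have hN' : (0 : ℝ) < N := Nat.cast_pos.2 hN
  have hs : √(N : ℝ) * √(N : ℝ) = N := Real.mul_self_sqrt hN'.le
  have hs0 : √(N : ℝ) ≠ 0 := (Real.sqrt_pos.2 hN').ne'
  have hinv : (√(N : ℝ))⁻¹ = √(N : ℝ) * (N : ℝ)⁻¹ := by
    rw [eq_mul_inv_iff_mul_eq₀ hN'.ne', inv_mul_eq_iff_eq_mul₀ hs0]
    exact hs.symm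
  simp only [centeredScore, centeredGrad, twoSampleAvg, PiLp.smul_apply, PiLp.add_apply,
    WithLp.ofLp_sum, Finset.sum_apply, Finset.sum_sub_distrib, Finset.sum_const, Finset.card_range,
    nsmul_eq_mul, smul_eq_mul]
  rw [hinv]
  field_simp
  ring

/-- The Hessian of the limiting criterion. -/
def limitHessian (Q Q' : Measure 𝒳) (ν : ℝ) (f g : 𝒳 → Param d → ℝ) (ξ : Param d) :
    Matrix (Fin (d + 1)) (Fin (d + 1)) ℝ :=
  Matrix.of fun i j => ∫ z, partial2 (f z) i j ξ ∂Q + ν * ∫ z, partial2 (g z) i j ξ ∂Q'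

/-- The asymptotic covariance of the score. -/
def scoreCovariance (Q Q' : Measure 𝒳) (ν : ℝ) (f g : 𝒳 → Param d → ℝ) (ξ : Param d) :
    Matrix (Fin (d + 1)) (Fin (d + 1)) ℝ :=
  Matrix.of fun i j => covariance (fun z => partial1 (f z) i ξ) (fun z => partial1 (f z) j ξ) Q
    + ν * covariance (fun z => partial1 (g z) i ξ) (fun z => partial1 (g z) j ξ) Q'

/-- Reconciles the index order of coordinate Jacobians with `mulVec`, and removes the transpose from
the sandwich covariance. -/
lemma transpose_limitHessian (hf : SmoothLoss Q f L ξ0 δ) (hg : SmoothLoss Q' g L ξ0 δ) :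
    (limitHessian Q Q' ν f g ξ0).transpose = limitHessian Q Q' ν f g ξ0 := by
  ext i j
  simp only [limitHessian, Matrix.transpose_apply, Matrix.of_apply]
  have h0 : ξ0 ∈ Metric.ball ξ0 δ := Metric.mem_ball_self hf.pos
  simp_rw [fun z => partial2_comm (hf.contDiffAt z h0) j i,
    fun z => partial2_comm (hg.contDiffAt z h0) j i]

lemma measurable_centeredGrad (hf : SmoothLoss Q f L ξ0 δ) {ξ : Param d}
    (hξ : ξ ∈ Metric.ball ξ0 δ) : Measurable (centeredGrad Q f ξ) := by
  refine (WithLp.measurable_toLp 2 _).comp (measurable_pi_lambda _ fun i => ?_)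
  exact (hf.measurable_partial1 hξ i).sub_const _

lemma aemeasurable_centeredScore (h : TwoSample P Q Q' X Y N M ν) (hf : SmoothLoss Q f L ξ0 δ)
    (hg : SmoothLoss Q' g L ξ0 δ) {ξ : Param d} (hξ : ξ ∈ Metric.ball ξ0 δ) (n m : ℕ) :
    AEMeasurable (fun ω => centeredScore Q Q' f g n m (fun t => X t ω) (fun t => Y t ω) ξ) P :=
  ((Finset.aemeasurable_fun_sum _ fun t _ => (measurable_centeredGrad hf hξ).comp_aemeasurable
      (h.hasLaw_left t).aemeasurable).add
    (Finset.aemeasurable_fun_sum _ fun t _ => (measurable_centeredGrad hg hξ).comp_aemeasurable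
      (h.hasLaw_right t).aemeasurable)).fun_const_smul _

/-- Asymptotic normality of the score at the limiting minimizer. -/
lemma tendstoInDistribution_centeredScore [IsProbabilityMeasure P] [IsProbabilityMeasure Q]
    [IsProbabilityMeasure Q'] (h : TwoSample P Q Q' X Y N M ν)
    (hf : SmoothLoss Q f L ξ0 δ) (hg : SmoothLoss Q' g L ξ0 δ)
    (hf2 : ∀ i, MemLp (fun z => partial1 (f z) i ξ0) 2 Q)
    (hg2 : ∀ i, MemLp (fun z => partial1 (g z) i ξ0) 2 Q') :
    (scoreCovariance Q Q' ν f g ξ0).PosSemidef ∧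
    TendstoInDistribution (fun s ω => centeredScore Q Q' f g (N s) (M s) (fun t => X t ω)
      (fun t => Y t ω) ξ0) atTop id (fun _ => P)
      (multivariateGaussian 0 (scoreCovariance Q Q' ν f g ξ0)) := by
  have h0 : ξ0 ∈ Metric.ball ξ0 δ := Metric.mem_ball_self hf.pos
  have hV2 : ∀ i, MemLp (fun z => centeredGrad Q f ξ0 z i) 2 Q := fun i =>
    (hf2 i).sub (memLp_const _)
  have hW2 : ∀ i, MemLp (fun z => centeredGrad Q' g ξ0 z i) 2 Q' := fun i =>
    (hg2 i).sub (memLp_const _)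
  have hcov : scoreCovariance Q Q' ν f g ξ0
      = secondMoment Q (centeredGrad Q f ξ0) + ν • secondMoment Q' (centeredGrad Q' g ξ0) := rfl
  rw [hcov]
  refine ⟨(posSemidef_secondMoment hV2).add ((posSemidef_secondMoment hW2).smul h.pos.le), ?_⟩
  refine two_sample_clt h.hasLaw_left h.hasLaw_right h.indep h.left_pos h.tendsto_left
    h.tendsto_right h.pos h.tendsto_ratio (measurable_centeredGrad hf h0)
    (measurable_centeredGrad hg h0) hV2 hW2 (fun i => ?_) (fun i => ?_)
  · simp only [centeredGrad]
    rw [integral_sub ((hf2 i).integrable one_le_two) (integrable_const _)]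
    simp
  · simp only [centeredGrad]
    rw [integral_sub ((hg2 i).integrable one_le_two) (integrable_const _)]
    simp

/-- The empirical Hessians converge uniformly near the limiting minimizer. -/
lemma ae_tendstoUniformlyOn_hessian [IsProbabilityMeasure P] (h : TwoSample P Q Q' X Y N M ν)
    (hf : SmoothLoss Q f L ξ0 δ) (hg : SmoothLoss Q' g L ξ0 δ) :
    ∀ᵐ ω ∂P, ∀ i j, TendstoUniformlyOn
      (fun s ξ => twoSampleAvg (N s) (M s) (fun t => X t ω) (fun t => Y t ω)
        (fun z => partial2 (f z) i j ξ) fun z => partial2 (g z) i j ξ)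
      (fun ξ => limitHessian Q Q' ν f g ξ i j) atTop (Metric.ball ξ0 (δ / 2)) := by
  rw [ae_all_iff]
  intro i
  rw [ae_all_iff]
  intro j
  have h1 := hf.ae_tendstoUniformlyOn_partial2 h.hasLaw_left h.indep_left i j
  have h2 := hg.ae_tendstoUniformlyOn_partial2 h.hasLaw_right h.indep_right i j
  filter_upwards [h1.1, h2.1] with ω hω1 hω2
  exact (h.tendstoUniformlyOn_twoSampleAvg (φ := fun z => partial2 (f z) i j)
    (ψ := fun z => partial2 (g z) i j) (isCompact_closedBall _ _) hω1 hω2 h2.2).mono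
    Metric.ball_subset_closedBall

end Limit

/-! ### Linearized equations in vector form. -/

section Vector

variable {d : ℕ}

lemma norm_le_sum_abs (w : Param d) : ‖w‖ ≤ ∑ i, |w i| := by
  conv_lhs => rw [← sum_smul_basisVec w]
  refine (norm_sum_le _ _).trans (Finset.sum_le_sum fun i _ => ?_)
  simp [norm_smul, basisVec]

lemma isLittleO_of_coord {E : Type*} [NormedAddCommGroup E] {w : ℕ → Param d} {v : ℕ → E}
    (h : ∀ i, (fun s => w s i) =o[atTop] v) : w =o[atTop] v := by
  have h1 : w =O[atTop] fun s => ∑ i, |w s i| :=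
    Asymptotics.IsBigO.of_bound 1 (Eventually.of_forall fun s => by
      rw [one_mul]
      exact (norm_le_sum_abs (w s)).trans (le_abs_self _))
  exact h1.trans_isLittleO (Asymptotics.IsLittleO.fun_sum fun i _ => (h i).abs_left)

/-- Vector form of `isLittleO_gradient_sub` when the limiting Jacobian is symmetric. -/
lemma isLittleO_gradient_sub_vec {p : ℕ → Fin (d + 1) → Param d → ℝ}
    {q : ℕ → Fin (d + 1) → Fin (d + 1) → Param d → ℝ} {h : Fin (d + 1) → Fin (d + 1) → Param d → ℝ}
    {ξ0 : Param d} {δ : ℝ} (hδ : 0 < δ)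
    (hp : ∀ s j, ∀ ξ ∈ Metric.ball ξ0 δ, HasFDerivAt (p s j) (coordForm fun i => q s i j ξ) ξ)
    (hq : ∀ i j, TendstoUniformlyOn (fun s => q s i j) (h i j) atTop (Metric.ball ξ0 δ))
    (hh : ∀ i j, ContinuousAt (h i j) ξ0) {H : Matrix (Fin (d + 1)) (Fin (d + 1)) ℝ}
    (hH : ∀ i j, H i j = h i j ξ0) (hsymm : H.transpose = H) {x y : ℕ → Param d}
    (hx : Tendsto x atTop (𝓝 ξ0)) (hy : Tendsto y atTop (𝓝 ξ0)) :
    (fun s => (WithLp.toLp 2 (fun j => p s j (x s) - p s j (y s)) : Param d)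
      - Matrix.toEuclideanCLM (𝕜 := ℝ) H (x s - y s)) =o[atTop] fun s => x s - y s := by
  refine isLittleO_of_coord fun j => ?_
  refine (isLittleO_gradient_sub hδ hp hq hh hx hy j).congr_left fun s => ?_
  simp only [PiLp.sub_apply, Matrix.ofLp_toEuclideanCLM, Matrix.mulVec, dotProduct]
  congr 1
  refine Finset.sum_congr rfl fun i _ => ?_
  rw [← hH, ← hsymm, Matrix.transpose_apply, hsymm]

/-- An equation `H Δ + W = o(Δ)` with nonsingular `H` is solved by `Δ = T + o(T)` with
`T = - H⁻¹ W`. -/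
lemma isLittleO_of_linear_equation {H : Matrix (Fin (d + 1)) (Fin (d + 1)) ℝ} (hH : IsUnit H)
    {Δ W : ℕ → Param d}
    (h : (fun s => Matrix.toEuclideanCLM (𝕜 := ℝ) H (Δ s) + W s) =o[atTop] Δ) :
    (fun s => Δ s - Matrix.toEuclideanCLM (𝕜 := ℝ) (-H⁻¹) (W s)) =o[atTop]
      fun s => Matrix.toEuclideanCLM (𝕜 := ℝ) (-H⁻¹) (W s) := by
  set B := Matrix.toEuclideanCLM (𝕜 := ℝ) H⁻¹ with hB
  have hinv : ∀ v : Param d, B (Matrix.toEuclideanCLM (𝕜 := ℝ) H v) = v := fun v => by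
    have hdet : IsUnit H.det := (Matrix.isUnit_iff_isUnit_det H).1 hH
    have := map_mul (Matrix.toEuclideanCLM (n := Fin (d + 1)) (𝕜 := ℝ)) H⁻¹ H
    rw [Matrix.nonsing_inv_mul H hdet, map_one] at this
    exact (DFunLike.congr_fun this v).symm
  have hneg : ∀ v, Matrix.toEuclideanCLM (𝕜 := ℝ) (-H⁻¹) v = -B v := fun v => by
    rw [map_neg]; rfl
  simp_rw [hneg]
  have h1 : (fun s => Δ s - -B (W s)) =o[atTop] Δ := by
    have h2 := (B.isBigO_comp (fun s => Matrix.toEuclideanCLM (𝕜 := ℝ) H (Δ s) + W s)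
      atTop).trans_isLittleO h
    refine h2.congr_left fun s => ?_
    rw [map_add, hinv, sub_neg_eq_add]
  -- From `Δ - T = o(Δ)` it follows that `Δ = O(Δ - (Δ - T)) = O(T)`, so the error is also `o(T)`.
  refine h1.trans_isBigO (h1.right_isBigO_sub.congr_right fun s => ?_)
  simp

end Vector

/-! ### Moving the score from `ξ0` to the population minimizers. -/

section Limit

variable {Ω 𝒳 : Type*} [MeasurableSpace Ω] [MeasurableSpace 𝒳] {d : ℕ} {P : Measure Ω}
  {Q Q' : Measure 𝒳} {X Y : ℕ → Ω → 𝒳} {N M : ℕ → ℕ} {ν : ℝ} {f g : 𝒳 → Param d → ℝ}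
  {L : Set (Param d)} {ξ0 : Param d} {δ : ℝ}

/-- The limiting Hessian is continuous at the center, and the expected Hessians with varying weight
converge to it uniformly. -/
lemma limitHessian_regular [IsProbabilityMeasure P] (h : TwoSample P Q Q' X Y N M ν)
    (hf : SmoothLoss Q f L ξ0 δ) (hg : SmoothLoss Q' g L ξ0 δ) (i j : Fin (d + 1)) :
    ContinuousAt (fun ξ => limitHessian Q Q' ν f g ξ i j) ξ0 ∧
    TendstoUniformlyOn (fun s ξ => ∫ z, partial2 (f z) i j ξ ∂Q
        + (M s : ℝ) / (N s : ℝ) * ∫ z, partial2 (g z) i j ξ ∂Q')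
      (fun ξ => limitHessian Q Q' ν f g ξ i j) atTop (Metric.ball ξ0 (δ / 2)) := by
  have h1 := (hf.ae_tendstoUniformlyOn_partial2 h.hasLaw_left h.indep_left i j).2
  have h2 := (hg.ae_tendstoUniformlyOn_partial2 h.hasLaw_right h.indep_right i j).2
  have hn : Metric.closedBall ξ0 (δ / 2) ∈ 𝓝 ξ0 :=
    Metric.closedBall_mem_nhds _ (half_pos hf.pos)
  refine ⟨(h1.continuousAt hn).add ((h2.continuousAt hn).const_mul ν), ?_⟩
  obtain ⟨C, hC⟩ := (isCompact_closedBall ξ0 (δ / 2)).exists_bound_of_continuousOn h2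
  have hcst : ∀ F : Param d → ℝ, TendstoUniformlyOn (fun _ : ℕ => F) F atTop
      (Metric.ball ξ0 (δ / 2)) := fun F U hU =>
    Eventually.of_forall fun _ _ _ => refl_mem_uniformity hU
  exact tendstoUniformlyOn_add_mul (hcst _) (hcst _) h.tendsto_ratio
    fun ξ hξ => hC ξ (Metric.ball_subset_closedBall hξ)

/-- Critical points of the expected criteria approach the limiting minimizer at least as fast as
the ratio of the sample sizes approaches its limit. -/
lemma isBigO_sub_of_critical [IsProbabilityMeasure P] (h : TwoSample P Q Q' X Y N M ν)
    (hf : SmoothLoss Q f L ξ0 δ) (hg : SmoothLoss Q' g L ξ0 δ)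
    (hH : IsUnit (limitHessian Q Q' ν f g ξ0)) {y : ℕ → Param d} (hy : Tendsto y atTop (𝓝 ξ0))
    (hcrit : ∀ᶠ s in atTop, ∀ i, ∫ z, partial1 (f z) i (y s) ∂Q
      + (M s : ℝ) / (N s : ℝ) * ∫ z, partial1 (g z) i (y s) ∂Q' = 0)
    (hcrit0 : ∀ i, ∫ z, partial1 (f z) i ξ0 ∂Q + ν * ∫ z, partial1 (g z) i ξ0 ∂Q' = 0) :
    (fun s => y s - ξ0) =O[atTop] fun s => (M s : ℝ) / (N s : ℝ) - ν := by
  have key := isLittleO_gradient_sub_vec (half_pos hf.pos)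
    (p := fun s j ξ => ∫ z, partial1 (f z) j ξ ∂Q
      + (M s : ℝ) / (N s : ℝ) * ∫ z, partial1 (g z) j ξ ∂Q')
    (fun s j ξ hξ => hasFDerivAt_add_mul _ (hf.hasFDerivAt_integral_partial1 hξ j)
      (hg.hasFDerivAt_integral_partial1 hξ j))
    (fun i j => (limitHessian_regular h hf hg i j).2)
    (fun i j => (limitHessian_regular h hf hg i j).1) (H := limitHessian Q Q' ν f g ξ0)
    (fun i j => rfl) (transpose_limitHessian hf hg) hy tendsto_const_nhds
  set G : Param d := WithLp.toLp 2 fun j => ∫ z, partial1 (g z) j ξ0 ∂Q'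
  have key2 : (fun s => Matrix.toEuclideanCLM (𝕜 := ℝ) (limitHessian Q Q' ν f g ξ0) (y s - ξ0)
      + ((M s : ℝ) / (N s : ℝ) - ν) • G) =o[atTop] fun s => y s - ξ0 := by
    refine key.neg_left.congr' ?_ EventuallyEq.rfl
    filter_upwards [hcrit] with s hs
    -- With the actual weight the expected gradient vanishes at `y s`; at `ξ0` it differs from the
    -- vanishing limiting gradient only through the weight, by `(M / N - ν) • G`.
    have hv : (WithLp.toLp 2 fun j => (∫ z, partial1 (f z) j (y s) ∂Q
        + (M s : ℝ) / (N s : ℝ) * ∫ z, partial1 (g z) j (y s) ∂Q')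
        - (∫ z, partial1 (f z) j ξ0 ∂Q + (M s : ℝ) / (N s : ℝ) * ∫ z, partial1 (g z) j ξ0 ∂Q') :
        Param d) = -(((M s : ℝ) / (N s : ℝ) - ν) • G) := by
      ext j
      simp only [PiLp.neg_apply, PiLp.smul_apply, smul_eq_mul, G]
      rw [hs j]
      linear_combination -hcrit0 j
    rw [hv]
    abel
  have key3 := isLittleO_of_linear_equation hH key2
  set B := Matrix.toEuclideanCLM (𝕜 := ℝ) (-(limitHessian Q Q' ν f g ξ0)⁻¹)
  have hT : (fun s => B (((M s : ℝ) / (N s : ℝ) - ν) • G)) =O[atTop]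
      fun s => (M s : ℝ) / (N s : ℝ) - ν := by
    refine (B.isBigO_comp _ _).trans ?_
    have := (Asymptotics.isBigO_refl (fun s => (M s : ℝ) / (N s : ℝ) - ν) atTop).smul
      (Asymptotics.isBigO_const_const G (one_ne_zero (α := ℝ)) atTop)
    simpa using this
  have := (key3.isBigO.trans hT).add hT
  simpa using this

/-- The score at points converging fast enough to the limiting minimizer. -/
lemma ae_tendsto_centeredScore_sub [IsProbabilityMeasure P] (h : TwoSample P Q Q' X Y N M ν)
    (hf : SmoothLoss Q f L ξ0 δ) (hg : SmoothLoss Q' g L ξ0 δ) {y : ℕ → Param d}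
    (hy : Tendsto y atTop (𝓝 ξ0))
    (hrate : (fun s => y s - ξ0) =O[atTop] fun s => (√(N s : ℝ))⁻¹) :
    ∀ᵐ ω ∂P, Tendsto (fun s =>
      centeredScore Q Q' f g (N s) (M s) (fun t => X t ω) (fun t => Y t ω) (y s)
        - centeredScore Q Q' f g (N s) (M s) (fun t => X t ω) (fun t => Y t ω) ξ0) atTop (𝓝 0) := by
  have hsub : Metric.ball ξ0 (δ / 2) ⊆ Metric.ball ξ0 δ :=
    Metric.ball_subset_closedBall.trans hf.closedBall_subset
  filter_upwards [ae_tendstoUniformlyOn_hessian h hf hg] with ω hω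
  rw [← Asymptotics.isLittleO_one_iff ℝ]
  refine isLittleO_of_coord fun j => ?_
  -- Applied to empirical minus expected gradient: the Jacobians tend to zero uniformly, so the
  -- increment is `o(y s - ξ0)`, which `√N` keeps negligible.
  have key := isLittleO_gradient_sub (half_pos hf.pos)
    (p := fun s j ξ => twoSampleAvg (N s) (M s) (fun t => X t ω) (fun t => Y t ω)
        (fun z => partial1 (f z) j ξ) (fun z => partial1 (g z) j ξ)
      + (-1) * (∫ z, partial1 (f z) j ξ ∂Q
        + (M s : ℝ) / (N s : ℝ) * ∫ z, partial1 (g z) j ξ ∂Q'))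
    (h := fun _ _ _ => 0)
    (fun s j ξ hξ => hasFDerivAt_add_mul _
      (hasFDerivAt_twoSampleAvg (N s) (M s) _ _ (φ := fun z => partial1 (f z) j)
        (ψ := fun z => partial1 (g z) j) (fun z => hf.hasFDerivAt_partial1 z (hsub hξ) j)
        fun z => hg.hasFDerivAt_partial1 z (hsub hξ) j)
      (hasFDerivAt_add_mul _ (hf.hasFDerivAt_integral_partial1 hξ j)
      (hg.hasFDerivAt_integral_partial1 hξ j)))
    (fun i j => ?_) (fun i j => continuousAt_const) hy tendsto_const_nhds j
  · simp only [zero_mul, Finset.sum_const_zero, sub_zero] at key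
    have h1 := (Asymptotics.isBigO_refl (fun s => √(N s : ℝ)) atTop).mul_isLittleO
      (key.trans_isBigO hrate)
    refine (h1.congr (fun s => ?_) fun s => ?_)
    · rw [PiLp.sub_apply, centeredScore_apply _ _ _ _ (h.left_pos s),
        centeredScore_apply _ _ _ _ (h.left_pos s)]
      ring
    · exact mul_inv_cancel₀ (h.sqrt_pos s).ne'
  · have h1 := (hω i j)
    have h2 := (limitHessian_regular h hf hg i j).2
    rw [Metric.tendstoUniformlyOn_iff] at h1 h2 ⊢
    intro ε hε
    filter_upwards [h1 (ε / 2) (half_pos hε), h2 (ε / 2) (half_pos hε)] with s e1 e2 ξ hξ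
    have e1 := e1 ξ hξ
    have e2 := e2 ξ hξ
    rw [Real.dist_eq, abs_lt] at e1 e2 ⊢
    constructor <;> linarith [e1.1, e1.2, e2.1, e2.2]

/-- Gradients of a loss at moving points converge in mean square if their second moments do. -/
lemma tendstoInMeasure_centeredGrad_sum [IsProbabilityMeasure P] [IsProbabilityMeasure Q]
    (hX : ∀ t, HasLaw (X t) Q P) (hind : iIndepFun X P) {m : ℕ → ℕ} {c : ℝ}
    (hratio : Tendsto (fun s => (m s : ℝ) / (N s : ℝ)) atTop (𝓝 c))
    (hf : SmoothLoss Q f L ξ0 δ) {y : ℕ → Param d} (hyb : ∀ s, y s ∈ Metric.ball ξ0 (δ / 2))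
    (hy : Tendsto y atTop (𝓝 ξ0)) {i : Fin (d + 1)}
    (h0 : MemLp (fun z => partial1 (f z) i ξ0) 2 Q)
    (hm : ∀ s, MemLp (fun z => partial1 (f z) i (y s)) 2 Q)
    (hlim : Tendsto (fun s => ∫ z, partial1 (f z) i (y s) ^ 2 ∂Q) atTop
      (𝓝 (∫ z, partial1 (f z) i ξ0 ^ 2 ∂Q))) :
    TendstoInMeasure P (fun s ω => (√(N s : ℝ))⁻¹ * ∑ t ∈ Finset.range (m s),
      (centeredGrad Q f (y s) (X t ω) i - centeredGrad Q f ξ0 (X t ω) i)) atTop 0 := by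
  have hsub : Metric.ball ξ0 (δ / 2) ⊆ Metric.ball ξ0 δ :=
    Metric.ball_subset_closedBall.trans hf.closedBall_subset
  have hc : ξ0 ∈ Metric.ball ξ0 δ := Metric.mem_ball_self hf.pos
  have key := tendstoInMeasure_normalized_sum hX hind hratio
    (U := fun s z => partial1 (f z) i (y s) - partial1 (f z) i ξ0)
    (fun s => (hf.measurable_partial1 (hsub (hyb s)) i).sub (hf.measurable_partial1 hc i))
    (fun s => (hm s).sub h0)
    (tendsto_integral_sq_sub hm h0 (ae_of_all _ fun z =>
      (hf.hasFDerivAt_partial1 z hc i).continuousAt.tendsto.comp hy) hlim)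
  refine key.congr_left fun s => ae_of_all _ fun ω => ?_
  have hint : ∫ z, (partial1 (f z) i (y s) - partial1 (f z) i ξ0) ∂Q
      = ∫ z, partial1 (f z) i (y s) ∂Q - ∫ z, partial1 (f z) i ξ0 ∂Q :=
    integral_sub ((hm s).integrable one_le_two) (h0.integrable one_le_two)
  simp only [hint, centeredGrad]
  congr 1
  exact Finset.sum_congr rfl fun t _ => by ring

/-- The score at points converging to the limiting minimizer along which the second moments of the
gradients converge. -/
lemma tendstoInMeasure_centeredScore_sub [IsProbabilityMeasure P] [IsProbabilityMeasure Q]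
    [IsProbabilityMeasure Q'] (h : TwoSample P Q Q' X Y N M ν)
    (hf : SmoothLoss Q f L ξ0 δ) (hg : SmoothLoss Q' g L ξ0 δ) {y : ℕ → Param d}
    (hyb : ∀ s, y s ∈ Metric.ball ξ0 (δ / 2)) (hy : Tendsto y atTop (𝓝 ξ0))
    (hf2 : ∀ i, MemLp (fun z => partial1 (f z) i ξ0) 2 Q)
    (hg2 : ∀ i, MemLp (fun z => partial1 (g z) i ξ0) 2 Q')
    (hfy : ∀ i s, MemLp (fun z => partial1 (f z) i (y s)) 2 Q)
    (hgy : ∀ i s, MemLp (fun z => partial1 (g z) i (y s)) 2 Q')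
    (hflim : ∀ i, Tendsto (fun s => ∫ z, partial1 (f z) i (y s) ^ 2 ∂Q) atTop
      (𝓝 (∫ z, partial1 (f z) i ξ0 ^ 2 ∂Q)))
    (hglim : ∀ i, Tendsto (fun s => ∫ z, partial1 (g z) i (y s) ^ 2 ∂Q') atTop
      (𝓝 (∫ z, partial1 (g z) i ξ0 ^ 2 ∂Q'))) :
    TendstoInMeasure P (fun s ω =>
      centeredScore Q Q' f g (N s) (M s) (fun t => X t ω) (fun t => Y t ω) (y s)
        - centeredScore Q Q' f g (N s) (M s) (fun t => X t ω) (fun t => Y t ω) ξ0) atTop 0 := by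
  have hNN : Tendsto (fun s => (N s : ℝ) / (N s : ℝ)) atTop (𝓝 1) :=
    tendsto_const_nhds.congr fun s => (div_self (Nat.cast_ne_zero.2 (h.left_pos s).ne')).symm
  refine tendstoInMeasure_zero_of_norm_le_sum (κ := Fin (d + 1) ⊕ Fin (d + 1))
    (A := Sum.elim
      (fun i s ω => (√(N s : ℝ))⁻¹ * ∑ t ∈ Finset.range (N s),
        (centeredGrad Q f (y s) (X t ω) i - centeredGrad Q f ξ0 (X t ω) i))
      (fun i s ω => (√(N s : ℝ))⁻¹ * ∑ t ∈ Finset.range (M s),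
        (centeredGrad Q' g (y s) (Y t ω) i - centeredGrad Q' g ξ0 (Y t ω) i))) ?_ ?_
  · rintro (i | i)
    · exact tendstoInMeasure_centeredGrad_sum h.hasLaw_left h.indep_left hNN hf hyb hy (hf2 i)
        (hfy i) (hflim i)
    · exact tendstoInMeasure_centeredGrad_sum h.hasLaw_right h.indep_right h.tendsto_ratio hg hyb hy
        (hg2 i) (hgy i) (hglim i)
  · intro s ω
    rw [Fintype.sum_sum_type, ← Finset.sum_add_distrib]
    refine (norm_le_sum_abs _).trans (Finset.sum_le_sum fun i _ => ?_)
    refine (le_of_eq ?_).trans (abs_add_le _ _)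
    congr 1
    simp only [Sum.elim_inl, Sum.elim_inr, centeredScore, PiLp.sub_apply, PiLp.smul_apply,
      PiLp.add_apply, WithLp.ofLp_sum, Finset.sum_apply, smul_eq_mul, Finset.sum_sub_distrib]
    ring

end Limit

/-! ### Consistency and asymptotic normality for fixed losses. -/

section Estimator

variable {Ω 𝒳 : Type*} [MeasurableSpace Ω] [MeasurableSpace 𝒳] {d : ℕ} {P : Measure Ω}
  {Q Q' : Measure 𝒳} {X Y : ℕ → Ω → 𝒳} {N M : ℕ → ℕ} {ν : ℝ} {f g : 𝒳 → Param d → ℝ}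
  {L K : Set (Param d)} {ξ0 : Param d} {δ : ℝ}

/-- Minimizers of the expected criteria with varying weight converge. -/
lemma tendsto_populationMinimizer [IsProbabilityMeasure P] (h : TwoSample P Q Q' X Y N M ν)
    (hf : SmoothLoss Q f L ξ0 δ) (hg : SmoothLoss Q' g L ξ0 δ) (hK : IsCompact K) (hKL : K ⊆ L)
    (hξ0 : ξ0 ∈ K) {a : ℕ → Param d} (ha : Tendsto a atTop (𝓝 0))
    (haL : ∀ s, ∀ ξ ∈ K, ξ - a s ∈ L)
    (hmin : ∀ ξ ∈ K, ξ ≠ ξ0 → ∫ z, f z ξ0 ∂Q + ν * ∫ z, g z ξ0 ∂Q'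
      < ∫ z, f z ξ ∂Q + ν * ∫ z, g z ξ ∂Q')
    {ξs : ℕ → Param d} (hξs : ∀ s, ξs s ∈ K ∧ IsMinOn (fun ξ => ∫ z, f z (ξ - a s) ∂Q
      + (M s : ℝ) / (N s : ℝ) * ∫ z, g z (ξ - a s) ∂Q') K (ξs s)) :
    Tendsto ξs atTop (𝓝 ξ0) := by
  have hF := (hf.ae_tendstoUniformlyOn h.hasLaw_left h.indep_left).2
  have hG := (hg.ae_tendstoUniformlyOn h.hasLaw_right h.indep_right).2
  obtain ⟨C, hC⟩ := hf.isCompact.exists_bound_of_continuousOn hG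
  have hcst : ∀ F : Param d → ℝ, TendstoUniformlyOn (fun _ : ℕ => F) F atTop L :=
    fun F U hU => Eventually.of_forall fun _ _ _ => refl_mem_uniformity hU
  exact tendsto_of_isMinOn_shift hK hf.isCompact hKL (hF.add (hG.const_mul ν))
    (tendstoUniformlyOn_add_mul (hcst _) (hcst _) h.tendsto_ratio hC) ha haL hξ0 hmin
    (Eventually.of_forall fun s => (hξs s).1) (Eventually.of_forall fun s => (hξs s).2)

/-- Strong consistency of the minimizers of the empirical criteria. -/
lemma ae_tendsto_estimator [IsProbabilityMeasure P] (h : TwoSample P Q Q' X Y N M ν)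
    (hf : SmoothLoss Q f L ξ0 δ) (hg : SmoothLoss Q' g L ξ0 δ) (hK : IsCompact K) (hKL : K ⊆ L)
    (hξ0 : ξ0 ∈ K) {a : ℕ → Param d} (ha : Tendsto a atTop (𝓝 0))
    (haL : ∀ s, ∀ ξ ∈ K, ξ - a s ∈ L)
    (hmin : ∀ ξ ∈ K, ξ ≠ ξ0 → ∫ z, f z ξ0 ∂Q + ν * ∫ z, g z ξ0 ∂Q'
      < ∫ z, f z ξ ∂Q + ν * ∫ z, g z ξ ∂Q')
    {ξhat : ℕ → Ω → Param d} (hξhat : ∀ s, ∀ᵐ ω ∂P, ξhat s ω ∈ K ∧ IsMinOn (fun ξ =>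
      twoSampleAvg (N s) (M s) (fun t => X t ω) (fun t => Y t ω) (fun z => f z (ξ - a s))
        fun z => g z (ξ - a s)) K (ξhat s ω)) :
    ∀ᵐ ω ∂P, Tendsto (fun s => ξhat s ω) atTop (𝓝 ξ0) := by
  have hF := hf.ae_tendstoUniformlyOn h.hasLaw_left h.indep_left
  have hG := hg.ae_tendstoUniformlyOn h.hasLaw_right h.indep_right
  filter_upwards [hF.1, hG.1, ae_all_iff.2 hξhat] with ω h1 h2 h3
  exact tendsto_of_isMinOn_shift hK hf.isCompact hKL (hF.2.add (hG.2.const_mul ν))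
    (h.tendstoUniformlyOn_twoSampleAvg hf.isCompact h1 h2 hG.2) ha haL hξ0 hmin
    (Eventually.of_forall fun s => (h3 s).1) (Eventually.of_forall fun s => (h3 s).2)

/-- Asymptotic normality of the score at the population minimizers for the actual sample sizes. -/
lemma exists_tendstoInDistribution_centeredScore [IsProbabilityMeasure P] [IsProbabilityMeasure Q]
    [IsProbabilityMeasure Q'] (h : TwoSample P Q Q' X Y N M ν)
    (hf : SmoothLoss Q f L ξ0 δ) (hg : SmoothLoss Q' g L ξ0 δ)
    (hf2 : ∀ i, MemLp (fun z => partial1 (f z) i ξ0) 2 Q)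
    (hg2 : ∀ i, MemLp (fun z => partial1 (g z) i ξ0) 2 Q')
    (hH : IsUnit (limitHessian Q Q' ν f g ξ0)) {η : ℕ → Param d} (hη : Tendsto η atTop (𝓝 ξ0))
    (hcrit : ∀ᶠ s in atTop, ∀ i, ∫ z, partial1 (f z) i (η s) ∂Q
      + (M s : ℝ) / (N s : ℝ) * ∫ z, partial1 (g z) i (η s) ∂Q' = 0)
    (hcrit0 : ∀ i, ∫ z, partial1 (f z) i ξ0 ∂Q + ν * ∫ z, partial1 (g z) i ξ0 ∂Q' = 0)
    (hdrift : (fun s => (M s : ℝ) / (N s : ℝ) - ν) =O[atTop] (fun s => (√(N s : ℝ))⁻¹) ∨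
      ∀ i, ((∀ s, Integrable (fun z => partial1 (f z) i (η s) ^ 2) Q) ∧
        Tendsto (fun s => ∫ z, partial1 (f z) i (η s) ^ 2 ∂Q) atTop
          (𝓝 (∫ z, partial1 (f z) i ξ0 ^ 2 ∂Q))) ∧
        (∀ s, Integrable (fun z => partial1 (g z) i (η s) ^ 2) Q') ∧
        Tendsto (fun s => ∫ z, partial1 (g z) i (η s) ^ 2 ∂Q') atTop
          (𝓝 (∫ z, partial1 (g z) i ξ0 ^ 2 ∂Q'))) :
    ∃ y : ℕ → Param d, (∀ᶠ s in atTop, y s = η s) ∧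
      TendstoInDistribution (fun s ω => centeredScore Q Q' f g (N s) (M s) (fun t => X t ω)
        (fun t => Y t ω) (y s)) atTop id (fun _ => P)
        (multivariateGaussian 0 (scoreCovariance Q Q' ν f g ξ0)) := by
  classical
  have hsub : Metric.ball ξ0 (δ / 2) ⊆ Metric.ball ξ0 δ :=
    Metric.ball_subset_closedBall.trans hf.closedBall_subset
  have hball : ∀ᶠ s in atTop, η s ∈ Metric.ball ξ0 (δ / 2) :=
    hη (Metric.ball_mem_nhds _ (half_pos hf.pos))
  -- Convergence in distribution needs measurability at every index, so the finitely many points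
  -- outside the good ball are replaced by `ξ0`.
  set y : ℕ → Param d := fun s => if η s ∈ Metric.ball ξ0 (δ / 2) then η s else ξ0 with hydef
  have hyη : ∀ᶠ s in atTop, y s = η s := hball.mono fun s hs => if_pos hs
  have hyb : ∀ s, y s ∈ Metric.ball ξ0 (δ / 2) := fun s => by
    simp only [hydef]
    split_ifs with hs
    exacts [hs, hf.center_mem]
  have hy : Tendsto y atTop (𝓝 ξ0) := hη.congr' (hyη.mono fun s hs => hs.symm)
  have hT := (tendstoInDistribution_centeredScore h hf hg hf2 hg2).2
  have hm : ∀ s, AEMeasurable (fun ω => centeredScore Q Q' f g (N s) (M s) (fun t => X t ω)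
      (fun t => Y t ω) (y s)) P := fun s => aemeasurable_centeredScore h hf hg (hsub (hyb s)) _ _
  refine ⟨y, hyη, ?_⟩
  rcases hdrift with hrate | hmom
  · have hcrity : ∀ᶠ s in atTop, ∀ i, ∫ z, partial1 (f z) i (y s) ∂Q
        + (M s : ℝ) / (N s : ℝ) * ∫ z, partial1 (g z) i (y s) ∂Q' = 0 := by
      filter_upwards [hyη, hcrit] with s hs1 hs2
      rwa [hs1]
    have hO := (isBigO_sub_of_critical h hf hg hH hy hcrity hcrit0).trans hrate
    refine tendstoInDistribution_of_sub_isLittleO hT hm ?_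
    filter_upwards [ae_tendsto_centeredScore_sub h hf hg hy hO] with ω hω
    refine ((Asymptotics.isLittleO_one_iff ℝ).2 hω).trans_isBigO ?_
    refine Asymptotics.IsBigO.of_bound 1 (Eventually.of_forall fun s => ?_)
    rw [norm_one, one_mul, Real.norm_of_nonneg (by positivity)]
    exact le_add_of_nonneg_right (norm_nonneg _)
  · refine tendstoInDistribution_of_tendstoInMeasure_sub _ _ hT ?_ hm
    refine tendstoInMeasure_centeredScore_sub h hf hg hyb hy hf2 hg2 (fun i s => ?_)
      (fun i s => ?_) (fun i => (hmom i).1.2.congr' ?_) (fun i => (hmom i).2.2.congr' ?_)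
    · rw [memLp_two_iff_integrable_sq
        (hf.measurable_partial1 (hsub (hyb s)) i).aestronglyMeasurable]
      simp only [hydef]
      split_ifs
      exacts [(hmom i).1.1 s, (hf2 i).integrable_sq]
    · rw [memLp_two_iff_integrable_sq
        (hg.measurable_partial1 (hsub (hyb s)) i).aestronglyMeasurable]
      simp only [hydef]
      split_ifs
      exacts [(hmom i).2.1 s, (hg2 i).integrable_sq]
    · filter_upwards [hyη] with s hs
      rw [hs]
    · filter_upwards [hyη] with s hs
      rw [hs]

/-- Asymptotic normality of minimizers of two-sample criteria with smooth dominated losses, where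
the parameter set is shifted by a vanishing amount. -/
theorem tendstoInDistribution_estimator [IsProbabilityMeasure P] [IsProbabilityMeasure Q]
    [IsProbabilityMeasure Q'] (h : TwoSample P Q Q' X Y N M ν)
    (hf : SmoothLoss Q f L ξ0 δ) (hg : SmoothLoss Q' g L ξ0 δ) (hK : IsCompact K) (hKL : K ⊆ L)
    (hξ0 : ξ0 ∈ interior K) {a : ℕ → Param d} (ha : Tendsto a atTop (𝓝 0))
    (haL : ∀ s, ∀ ξ ∈ K, ξ - a s ∈ L)
    (hmin : ∀ ξ ∈ K, ξ ≠ ξ0 → ∫ z, f z ξ0 ∂Q + ν * ∫ z, g z ξ0 ∂Q'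
      < ∫ z, f z ξ ∂Q + ν * ∫ z, g z ξ ∂Q')
    {ξs : ℕ → Param d} (hξs : ∀ s, ξs s ∈ K ∧ IsMinOn (fun ξ => ∫ z, f z (ξ - a s) ∂Q
      + (M s : ℝ) / (N s : ℝ) * ∫ z, g z (ξ - a s) ∂Q') K (ξs s))
    {ξhat : ℕ → Ω → Param d} (hmeas : ∀ s, AEMeasurable (ξhat s) P)
    (hξhat : ∀ s, ∀ᵐ ω ∂P, ξhat s ω ∈ K ∧ IsMinOn (fun ξ =>
      twoSampleAvg (N s) (M s) (fun t => X t ω) (fun t => Y t ω) (fun z => f z (ξ - a s))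
        fun z => g z (ξ - a s)) K (ξhat s ω))
    (hf2 : ∀ i, MemLp (fun z => partial1 (f z) i ξ0) 2 Q)
    (hg2 : ∀ i, MemLp (fun z => partial1 (g z) i ξ0) 2 Q')
    (hH : IsUnit (limitHessian Q Q' ν f g ξ0))
    (hdrift : (fun s => (M s : ℝ) / (N s : ℝ) - ν) =O[atTop] (fun s => (√(N s : ℝ))⁻¹) ∨
      ∀ i, ((∀ s, Integrable (fun z => partial1 (f z) i (ξs s - a s) ^ 2) Q) ∧
        Tendsto (fun s => ∫ z, partial1 (f z) i (ξs s - a s) ^ 2 ∂Q) atTop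
          (𝓝 (∫ z, partial1 (f z) i ξ0 ^ 2 ∂Q))) ∧
        (∀ s, Integrable (fun z => partial1 (g z) i (ξs s - a s) ^ 2) Q') ∧
        Tendsto (fun s => ∫ z, partial1 (g z) i (ξs s - a s) ^ 2 ∂Q') atTop
          (𝓝 (∫ z, partial1 (g z) i ξ0 ^ 2 ∂Q')))
    {c : ℕ → ℝ} {c0 : ℝ} (hc : Tendsto c atTop (𝓝 c0)) :
    TendstoInDistribution (fun s ω => c s • √(N s : ℝ) • (ξhat s ω - ξs s)) atTop id (fun _ => P)
      (multivariateGaussian 0 (c0 ^ 2 • ((limitHessian Q Q' ν f g ξ0)⁻¹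
        * scoreCovariance Q Q' ν f g ξ0 * (limitHessian Q Q' ν f g ξ0)⁻¹))) := by
  have hξ0K : ξ0 ∈ K := interior_subset hξ0
  have hhalf : 0 < δ / 2 := half_pos hf.pos
  have hsub : Metric.ball ξ0 (δ / 2) ⊆ Metric.ball ξ0 δ :=
    Metric.ball_subset_closedBall.trans hf.closedBall_subset
  have hint : interior K ∈ 𝓝 ξ0 := isOpen_interior.mem_nhds hξ0
  have hlim := tendsto_populationMinimizer h hf hg hK hKL hξ0K ha haL hmin hξs
  -- `ξs s - a s` is where the unshifted criterion is critical once `ξs s` is interior to `K`.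
  have hη : Tendsto (fun s => ξs s - a s) atTop (𝓝 ξ0) := by simpa using hlim.sub ha
  have hcrit : ∀ᶠ s in atTop, ∀ i, ∫ z, partial1 (f z) i (ξs s - a s) ∂Q
      + (M s : ℝ) / (N s : ℝ) * ∫ z, partial1 (g z) i (ξs s - a s) ∂Q' = 0 := by
    filter_upwards [hη (Metric.ball_mem_nhds _ hhalf), hlim hint] with s hs1 hs2 i
    exact coeff_eq_zero_of_isMinOn (D := fun η => ∫ z, f z η ∂Q
        + (M s : ℝ) / (N s : ℝ) * ∫ z, g z η ∂Q') (hξs s).2 hs2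
      (hasFDerivAt_add_mul _ (hf.hasFDerivAt_integral hs1) (hg.hasFDerivAt_integral hs1)) i
  have hcrit0 : ∀ i, ∫ z, partial1 (f z) i ξ0 ∂Q + ν * ∫ z, partial1 (g z) i ξ0 ∂Q' = 0 := by
    intro i
    refine coeff_eq_zero_of_isMinOn (a := 0) (x := ξ0) (K := K) (c := fun i =>
      ∫ z, partial1 (f z) i ξ0 ∂Q + ν * ∫ z, partial1 (g z) i ξ0 ∂Q')
      (D := fun η => ∫ z, f z η ∂Q + ν * ∫ z, g z η ∂Q') ?_ hξ0 ?_ i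
    · intro ξ hξ
      simp only [sub_zero, Set.mem_ofPred_eq]
      rcases eq_or_ne ξ ξ0 with rfl | hne
      exacts [le_rfl, (hmin ξ hξ hne).le]
    · rw [sub_zero]
      exact hasFDerivAt_add_mul _ (hf.hasFDerivAt_integral hf.center_mem)
        (hg.hasFDerivAt_integral hf.center_mem)
  obtain ⟨y, hyη, hscore⟩ := exists_tendstoInDistribution_centeredScore h hf hg hf2 hg2 hH hη hcrit
    hcrit0 hdrift
  have hy : Tendsto y atTop (𝓝 ξ0) := hη.congr' (hyη.mono fun s hs => hs.symm)
  set H := limitHessian Q Q' ν f g ξ0 with hHdef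
  set B := Matrix.toEuclideanCLM (𝕜 := ℝ) (-H⁻¹) with hB
  have hT := hscore.continuous_comp B.continuous
  have hZm : ∀ s, AEMeasurable (fun ω => √(N s : ℝ) • (ξhat s ω - ξs s)) P := fun s =>
    ((hmeas s).sub_const _).fun_const_smul _
  have hZ := tendstoInDistribution_of_sub_isLittleO hT hZm (by
    filter_upwards [ae_tendsto_estimator h hf hg hK hKL hξ0K ha haL hmin hξhat,
      ae_tendstoUniformlyOn_hessian h hf hg, ae_all_iff.2 hξhat] with ω hω1 hω2 hω3
    have hx : Tendsto (fun s => ξhat s ω - a s) atTop (𝓝 ξ0) := by simpa using hω1.sub ha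
    have key := isLittleO_gradient_sub_vec hhalf
      (p := fun s j ξ => twoSampleAvg (N s) (M s) (fun t => X t ω) (fun t => Y t ω)
        (fun z => partial1 (f z) j ξ) (fun z => partial1 (g z) j ξ))
      (fun s j ξ hξ => hasFDerivAt_twoSampleAvg (N s) (M s) _ _ (φ := fun z => partial1 (f z) j)
        (ψ := fun z => partial1 (g z) j) (fun z => hf.hasFDerivAt_partial1 z (hsub hξ) j)
        fun z => hg.hasFDerivAt_partial1 z (hsub hξ) j)
      hω2 (fun i j => (limitHessian_regular h hf hg i j).1) (H := H)
      (fun i j => rfl) (transpose_limitHessian hf hg) hx hy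
    have key2 := (Asymptotics.isBigO_refl (fun s => √(N s : ℝ)) atTop).smul_isLittleO key.neg_left
    -- The estimating equation `H Δ + W = o(Δ)`: the empirical gradient vanishes at the shifted
    -- estimator, and `√N` times its value at `y s` is the centred score because the expected
    -- gradient vanishes there.
    have key3 : (fun s => Matrix.toEuclideanCLM (𝕜 := ℝ) H (√(N s : ℝ) • (ξhat s ω - ξs s))
        + centeredScore Q Q' f g (N s) (M s) (fun t => X t ω) (fun t => Y t ω) (y s)) =o[atTop]
        fun s => √(N s : ℝ) • (ξhat s ω - ξs s) := by
      -- The shift `a s` cancels, as both minimizers are shifted alike.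
      have hdiff : ∀ᶠ s in atTop, ξhat s ω - a s - y s = ξhat s ω - ξs s := by
        filter_upwards [hyη] with s hs
        rw [hs]
        abel
      refine key2.congr' ?_ (hdiff.mono fun s hs => by simp only [hs])
      filter_upwards [hdiff, hyη, hcrit, hx (Metric.ball_mem_nhds _ hhalf), hω1 hint]
        with s e1 e2 e3 e4 e5
      have hzero : ∀ j, twoSampleAvg (N s) (M s) (fun t => X t ω) (fun t => Y t ω)
          (fun z => partial1 (f z) j (ξhat s ω - a s))
          (fun z => partial1 (g z) j (ξhat s ω - a s)) = 0 := fun j =>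
        coeff_eq_zero_of_isMinOn (D := fun η => twoSampleAvg (N s) (M s) (fun t => X t ω)
          (fun t => Y t ω) (fun z => f z η) fun z => g z η) (hω3 s).2 e5
          (hasFDerivAt_twoSampleAvg (N s) (M s) _ _ (fun z => hf.hasFDerivAt z (hsub e4))
            fun z => hg.hasFDerivAt z (hsub e4)) j
      simp only [hzero, zero_sub]
      rw [e1, neg_sub, smul_sub, map_smul, sub_eq_add_neg, ← smul_neg]
      congr 1
      ext j
      rw [centeredScore_apply _ _ _ _ (h.left_pos s), e2, e3 j]
      simp
    refine (isLittleO_of_linear_equation hH key3).trans_isBigO ?_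
    refine Asymptotics.IsBigO.of_bound 1 (Eventually.of_forall fun s => ?_)
    rw [one_mul, Real.norm_of_nonneg (by positivity)]
    exact le_add_of_nonneg_left zero_le_one)
  refine TendstoInDistribution.id_of_map_eq (TendstoInDistribution.smul_tendsto hZ hc) ?_
  have hmap : (fun x : Param d => c0 • (B ∘ id) x)
      = Matrix.toEuclideanCLM (𝕜 := ℝ) (c0 • -H⁻¹) := by
    ext1 x
    rw [map_smul]
    rfl
  rw [hmap, map_multivariateGaussian (tendstoInDistribution_centeredScore h hf hg hf2 hg2).1]
  congr 1
  rw [Matrix.transpose_smul, Matrix.transpose_neg, Matrix.transpose_nonsing_inv,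
    transpose_limitHessian hf hg, ← hHdef]
  simp [smul_smul, sq]

end Estimator

/-! ### Translates of the parameter set. -/

section Shift

variable {𝒳 : Type*} [MeasurableSpace 𝒳] {d : ℕ}

lemma partial1_comp_sub (f : Param d → ℝ) (a ξ : Param d) (i : Fin (d + 1)) :
    partial1 (fun η => f (η - a)) i ξ = partial1 f i (ξ - a) := by
  rw [partial1, partial1, fderiv_comp_sub]

lemma partial2_comp_sub (f : Param d → ℝ) (a ξ : Param d) (i j : Fin (d + 1)) :
    partial2 (fun η => f (η - a)) i j ξ = partial2 f i j (ξ - a) := by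
  rw [partial2, partial2, iteratedFDeriv_comp_sub]

/-- The set `K` together with all its translates by the vectors `-a s`. -/
def shiftHull (K : Set (Param d)) (a : ℕ → Param d) : Set (Param d) :=
  (fun x : Param d × Param d => x.1 - x.2) '' (K ×ˢ insert 0 (Set.range a))

lemma subset_shiftHull (K : Set (Param d)) (a : ℕ → Param d) : K ⊆ shiftHull K a :=
  fun ξ hξ => ⟨(ξ, 0), ⟨hξ, Set.mem_insert _ _⟩, sub_zero ξ⟩

lemma sub_mem_shiftHull {K : Set (Param d)} (a : ℕ → Param d) (s : ℕ) {ξ : Param d} (hξ : ξ ∈ K) :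
    ξ - a s ∈ shiftHull K a :=
  ⟨(ξ, a s), ⟨hξ, Set.mem_insert_of_mem _ ⟨s, rfl⟩⟩, rfl⟩

lemma mem_shiftHull {K : Set (Param d)} {a : ℕ → Param d} {η : Param d} (h : η ∈ shiftHull K a) :
    η ∈ K ∨ ∃ s, ∃ ξ ∈ K, η = ξ - a s := by
  obtain ⟨⟨ξ, b⟩, ⟨hξ, hb⟩, rfl⟩ := h
  rcases hb with hb | ⟨s, hs⟩
  · left
    have hb' : b = 0 := hb
    simpa [hb'] using hξ
  · exact Or.inr ⟨s, ξ, hξ, by simp [hs]⟩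

lemma isCompact_shiftHull {K : Set (Param d)} (hK : IsCompact K) {a : ℕ → Param d}
    (ha : Tendsto a atTop (𝓝 0)) : IsCompact (shiftHull K a) :=
  (hK.prod ha.isCompact_insert_range).image (by fun_prop)

/-- Envelopes for all vanishing translates of a loss make it a smooth dominated loss. -/
lemma smoothLoss_of_shift {Q : Measure 𝒳} {f : 𝒳 → Param d → ℝ} {K : Set (Param d)}
    (hK : IsCompact K) {a : ℕ → Param d} (ha : Tendsto a atTop (𝓝 0)) {ξ0 : Param d} {δ : ℝ}
    (hδ : 0 < δ) (hball : Metric.ball ξ0 (2 * δ) ⊆ K)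
    (hmeas : ∀ ξ ∈ shiftHull K a, Measurable fun z => f z ξ)
    (hsmooth : ∀ z, ∀ ξ ∈ shiftHull K a, ContDiffAt ℝ 2 (f z) ξ) {b : 𝒳 → ℝ} (hb : Integrable b Q)
    (hfb : ∀ᵐ z ∂Q, ∀ s, ∀ ξ ∈ K, |f z (ξ - a s)| ≤ b z ∧
      ∀ i j, |partial2 (f z) i j (ξ - a s)| ≤ b z) :
    SmoothLoss Q f (shiftHull K a) ξ0 δ := by
  have hsub : Metric.ball ξ0 δ ⊆ shiftHull K a :=
    ((Metric.ball_subset_ball (by linarith)).trans hball).trans (subset_shiftHull K a)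
  refine ⟨isCompact_shiftHull hK ha, hδ, hsub, hmeas,
    fun z ξ hξ => (hsmooth z ξ hξ).continuousAt.continuousWithinAt,
    fun z ξ hξ => (hsmooth z ξ (hsub hξ)).contDiffWithinAt, b, hb, ?_⟩
  -- One index with a small shift bounds the second derivatives on the whole ball: `η = (η + a s) -
  -- a s`, with `η + a s` in the ball of radius `2 * δ`, hence in `K`.
  obtain ⟨s, hs⟩ := (ha.eventually (Metric.ball_mem_nhds 0 hδ)).exists
  filter_upwards [hfb] with z hz
  refine ⟨fun η hη => ?_, fun η hη i j => ?_⟩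
  · rcases mem_shiftHull hη with hηK | ⟨t, ξ, hξ, rfl⟩
    -- The envelope controls only translated points; at an untranslated point it holds in the limit,
    -- by continuity.
    · have hlim : Tendsto (fun t => |f z (η - a t)|) atTop (𝓝 |f z η|) := by
        refine ((hsmooth z η hη).continuousAt.tendsto.comp ?_).abs
        simpa using tendsto_const_nhds.sub ha
      exact le_of_tendsto' hlim fun t => (hz t η hηK).1
    · exact (hz t ξ hξ).1
  · have hmem : η + a s ∈ K := by
      refine hball ?_
      have h1 : dist (a s) 0 < δ := hs
      rw [Metric.mem_ball, dist_eq_norm] at hη ⊢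
      rw [dist_zero_right] at h1
      calc ‖η + a s - ξ0‖ = ‖(η - ξ0) + a s‖ := by congr 1; abel
        _ ≤ ‖η - ξ0‖ + ‖a s‖ := norm_add_le _ _
        _ < 2 * δ := by linarith
    simpa using (hz s _ hmem).2 i j

end Shift

/-! ### The model: smoothness, and the ratio of sizes as a translation. -/

section Model

variable {𝒳 : Type*} [MeasurableSpace 𝒳] {d : ℕ} (S : NCESetting 𝒳 d)

instance : IsProbabilityMeasure S.dataLaw :=
  ⟨by rw [dataLaw, withDensity_apply _ MeasurableSet.univ, setLIntegral_univ, S.lintegral_q]⟩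

instance : IsProbabilityMeasure S.noiseLaw :=
  ⟨by rw [noiseLaw, withDensity_apply _ MeasurableSet.univ, setLIntegral_univ, S.lintegral_n]⟩

lemma contDiff_thetaPart {k : WithTop ℕ∞} : ContDiff ℝ k (thetaPart : Param d → _) := by
  rw [contDiff_euclidean]
  intro i
  simp only [thetaPart]
  fun_prop

lemma contDiff_cPart {k : WithTop ℕ∞} : ContDiff ℝ k (cPart : Param d → ℝ) := by
  unfold cPart
  fun_prop

variable {S}

lemma p_pos (h : S.N2) {ξ : Param d} (hξ : thetaPart ξ ∈ S.Θ) (z : 𝒳) : 0 < S.p ξ z :=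
  mul_pos ((h z).1 _ hξ) (Real.exp_pos _)

lemma contDiffAt_p (h : S.N2) {ξ : Param d} (hξ : thetaPart ξ ∈ S.Θ) (z : 𝒳) :
    ContDiffAt ℝ 2 (fun η => S.p η z) ξ := by
  have hlog : ContDiffAt ℝ 2 (fun η : Param d => Real.log (S.ptilde (thetaPart η) z)) ξ :=
    (((h z).2.contDiffAt (S.isOpen_Θ.mem_nhds hξ)).of_le (by norm_num)).comp ξ
      contDiff_thetaPart.contDiffAt
  -- Smoothness is assumed for `log ptilde`, so near `ξ` the model is written as the exponential of
  -- this logarithm times `exp c`.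
  refine (hlog.exp.mul contDiff_cPart.contDiffAt.exp).congr_of_eventuallyEq ?_
  have hopen : ∀ᶠ η in 𝓝 ξ, thetaPart η ∈ S.Θ :=
    (contDiff_thetaPart (k := 0)).continuous.continuousAt (S.isOpen_Θ.mem_nhds hξ)
  filter_upwards [hopen] with η hη
  rw [p, Real.exp_log ((h z).1 _ hη)]

lemma contDiffAt_rhoD (h : S.N2) {ν : ℝ} (hν : 0 < ν) {ξ : Param d} (hξ : thetaPart ξ ∈ S.Θ)
    (z : 𝒳) : ContDiffAt ℝ 2 (S.rhoD 1 ν z) ξ := by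
  have hp := contDiffAt_p h hξ z
  have hpos := p_pos h hξ z
  have hn := mul_nonneg hν.le (S.n_nonneg z)
  have h1 : 0 < 1 * S.p ξ z + ν * S.n z := by linarith
  exact (((contDiffAt_const.mul hp).div ((contDiffAt_const.mul hp).add contDiffAt_const)
    h1.ne').log (div_pos (by linarith) h1).ne').neg

lemma contDiffAt_rhoN (h : S.N2) {ν : ℝ} (hν : 0 < ν) {ξ : Param d} (hξ : thetaPart ξ ∈ S.Θ)
    (z : 𝒳) : ContDiffAt ℝ 2 (S.rhoN 1 ν z) ξ := by
  -- Where the noise density vanishes the loss is `-log 0`, which is constantly `0` by the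
  -- convention for `Real.log`.
  rcases (S.n_nonneg z).eq_or_lt with hn | hn
  · have : S.rhoN 1 ν z = fun _ => 0 := by
      ext η
      simp [rhoN, ← hn]
    rw [this]
    exact contDiffAt_const
  have hp := contDiffAt_p h hξ z
  have hpos := p_pos h hξ z
  have hνn := mul_pos hν hn
  have h1 : 0 < 1 * S.p ξ z + ν * S.n z := by linarith
  exact ((contDiffAt_const.div ((contDiffAt_const.mul hp).add contDiffAt_const)
    h1.ne').log (div_pos hνn h1).ne').neg

variable (S) in
lemma measurable_p {ξ : Param d} (hξ : thetaPart ξ ∈ S.Θ) : Measurable (S.p ξ) :=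
  (S.measurable_ptilde _ hξ).mul_const _

variable (S) in
lemma measurable_rhoD (N M : ℝ) {ξ : Param d} (hξ : thetaPart ξ ∈ S.Θ) :
    Measurable fun z => S.rhoD N M z ξ := by
  have hp := S.measurable_p hξ
  have hn := S.measurable_n
  unfold rhoD
  fun_prop

variable (S) in
lemma measurable_rhoN (N M : ℝ) {ξ : Param d} (hξ : thetaPart ξ ∈ S.Θ) :
    Measurable fun z => S.rhoN N M z ξ := by
  have hp := S.measurable_p hξ
  have hn := S.measurable_n
  unfold rhoN
  fun_prop

/-- The translation of the last coordinate that turns the ratio of sizes `r` into `ν`. -/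
def ratioShift (ν r : ℝ) : Param d := Real.log (r / ν) • basisVec (Fin.last d)

lemma tendsto_ratioShift {ν : ℝ} (hν : 0 < ν) {r : ℕ → ℝ} (hr : Tendsto r atTop (𝓝 ν)) :
    Tendsto (fun s => (ratioShift ν (r s) : Param d)) atTop (𝓝 0) := by
  have h1 : Tendsto (fun s => r s / ν) atTop (𝓝 1) := by
    simpa [hν.ne'] using hr.div_const ν
  have h2 : Tendsto (fun s => Real.log (r s / ν)) atTop (𝓝 0) := by
    simpa using h1.log one_ne_zero
  simpa [ratioShift] using h2.smul_const (basisVec (Fin.last d) : Param d)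

lemma thetaPart_sub_ratioShift (ν r : ℝ) (ξ : Param d) :
    thetaPart (ξ - ratioShift ν r) = thetaPart ξ := by
  ext i
  simp [thetaPart, ratioShift, basisVec]

variable (S) in
lemma p_sub_ratioShift {ν r : ℝ} (hν : 0 < ν) (hr : 0 < r) (ξ : Param d) (z : 𝒳) :
    S.p (ξ - ratioShift ν r) z = ν / r * S.p ξ z := by
  have hc : cPart (ξ - ratioShift ν r : Param d) = cPart ξ - Real.log (r / ν) := by
    simp [cPart, ratioShift, basisVec]
  rw [p, p, thetaPart_sub_ratioShift, hc, Real.exp_sub, Real.exp_log (by positivity)]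
  field_simp

variable (S) in
-- The translation multiplies `p` by `ν N / M`, so numerator and denominator at ratio `ν` become
-- those for `(N, M)` after multiplication by the common factor `M / ν`.
lemma rhoD_eq_shift {N M ν : ℝ} (hN : 0 < N) (hM : 0 < M) (hν : 0 < ν) (z : 𝒳) :
    S.rhoD N M z = fun ξ => S.rhoD 1 ν z (ξ - ratioShift ν (M / N)) := by
  ext ξ
  have hk : M / ν ≠ 0 := by positivity
  rw [rhoD, rhoD, S.p_sub_ratioShift hν (div_pos hM hN), ← mul_div_mul_left (1 * _) _ hk]
  congr 3 <;> field_simp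

variable (S) in
lemma rhoN_eq_shift {N M ν : ℝ} (hN : 0 < N) (hM : 0 < M) (hν : 0 < ν) (z : 𝒳) :
    S.rhoN N M z = fun ξ => S.rhoN 1 ν z (ξ - ratioShift ν (M / N)) := by
  ext ξ
  have hk : M / ν ≠ 0 := by positivity
  rw [rhoN, rhoN, S.p_sub_ratioShift hν (div_pos hM hN), ← mul_div_mul_left (ν * _) _ hk]
  congr 3 <;> field_simp

variable (S) in
lemma J_one_eq {ν : ℝ} (ξ : Param d) : S.J 1 ν ξ
    = (1 + ν)⁻¹ • limitHessian S.dataLaw S.noiseLaw ν (S.rhoD 1 ν) (S.rhoN 1 ν) ξ := by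
  ext i j
  simp only [J, limitHessian, Matrix.of_apply, Matrix.smul_apply, smul_eq_mul]
  ring

variable (S) in
lemma I_one_eq {ν : ℝ} (ξ : Param d) : S.I 1 ν ξ
    = (1 + ν)⁻¹ • scoreCovariance S.dataLaw S.noiseLaw ν (S.rhoD 1 ν) (S.rhoN 1 ν) ξ := by
  ext i j
  simp only [I, scoreCovariance, Matrix.of_apply, Matrix.smul_apply, smul_eq_mul]
  ring

/-- Each outer inverse contributes a factor `r` and the middle matrix `r⁻¹`, leaving a single `r`.
-/
lemma sandwich_smul {ι : Type*} [Fintype ι] [DecidableEq ι] {r : ℝ} (hr : r ≠ 0)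
    (H C : Matrix ι ι ℝ) (hH : IsUnit H) :
    (r⁻¹ • H)⁻¹ * (r⁻¹ • C) * (r⁻¹ • H)⁻¹ = r • (H⁻¹ * C * H⁻¹) := by
  have hdet := (Matrix.isUnit_iff_isUnit_det H).1 hH
  have hinv : (r⁻¹ • H)⁻¹ = r • H⁻¹ := by
    refine Matrix.inv_eq_right_inv ?_
    rw [Matrix.smul_mul, Matrix.mul_smul, smul_smul, inv_mul_cancel₀ hr, one_smul,
      Matrix.mul_nonsing_inv _ hdet]
  rw [hinv]
  simp only [Matrix.smul_mul, Matrix.mul_smul, smul_smul]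
  congr 1
  field_simp

end Model

/-! ### The NCE criteria in terms of the fixed losses. -/

section Losses

variable {𝒳 : Type*} [MeasurableSpace 𝒳] {d : ℕ} {S : NCESetting 𝒳 d} {N M : ℕ → ℕ} {ν : ℝ}
  {K : Set (Param d)}

/-- The translations that reduce the criteria for the sizes `(N s, M s)` to the ratio `ν`. -/
def sizeShift (ν : ℝ) (N M : ℕ → ℕ) (s : ℕ) : Param d := ratioShift ν ((M s : ℝ) / (N s : ℝ))

/-- Translations act on `c` alone, so they never leave the domain of the model. -/
lemma thetaPart_mem_of_mem_shiftHull (hKΘ : ∀ ξ ∈ K, thetaPart ξ ∈ S.Θ) {η : Param d}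
    (hη : η ∈ shiftHull K (sizeShift ν N M)) : thetaPart η ∈ S.Θ := by
  rcases mem_shiftHull hη with h | ⟨s, ξ, hξ, rfl⟩
  · exact hKΘ _ h
  · rw [sizeShift, thetaPart_sub_ratioShift]
    exact hKΘ _ hξ

/-- Under the regularity conditions both losses at the limiting ratio are smooth and dominated on
all translates of `K`. -/
lemma exists_smoothLoss (hK : IsCompact K) (hKΘ : ∀ ξ ∈ K, thetaPart ξ ∈ S.Θ)
    (hN0 : ∀ s, 0 < N s) (hM0 : ∀ s, 0 < M s) (hν : 0 < ν)
    (hNM : Tendsto (fun s => (M s : ℝ) / (N s : ℝ)) atTop (𝓝 ν)) {ξ0 : Param d}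
    (hξ0 : ξ0 ∈ interior K) (h2 : S.N2) (h4 : S.N4 K N M) :
    ∃ δ, SmoothLoss S.dataLaw (S.rhoD 1 ν) (shiftHull K (sizeShift ν N M)) ξ0 δ ∧
      SmoothLoss S.noiseLaw (S.rhoN 1 ν) (shiftHull K (sizeShift ν N M)) ξ0 δ := by
  obtain ⟨ε, hε, hball⟩ := Metric.mem_nhds_iff.1 (mem_interior_iff_mem_nhds.1 hξ0)
  have hball' : Metric.ball ξ0 (2 * (ε / 2)) ⊆ K := by rwa [mul_div_cancel₀ _ two_ne_zero]
  obtain ⟨bd, bn, hbd, hbn, hD, hE⟩ := h4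
  have ha : Tendsto (sizeShift ν N M : ℕ → Param d) atTop (𝓝 0) := tendsto_ratioShift hν hNM
  have hΘ : ∀ ξ ∈ shiftHull K (sizeShift ν N M), thetaPart ξ ∈ S.Θ :=
    fun ξ => thetaPart_mem_of_mem_shiftHull hKΘ
  refine ⟨ε / 2, smoothLoss_of_shift hK ha (half_pos hε) hball'
    (fun ξ hξ => S.measurable_rhoD 1 ν (hΘ ξ hξ)) (fun z ξ hξ => contDiffAt_rhoD h2 hν (hΘ ξ hξ) z)
    hbd ?_, smoothLoss_of_shift hK ha (half_pos hε) hball'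
    (fun ξ hξ => S.measurable_rhoN 1 ν (hΘ ξ hξ)) (fun z ξ hξ => contDiffAt_rhoN h2 hν (hΘ ξ hξ) z)
    hbn ?_⟩
  · filter_upwards [hD] with z hz s ξ hξ
    have := hz s ξ hξ
    rw [S.rhoD_eq_shift (Nat.cast_pos.2 (hN0 s)) (Nat.cast_pos.2 (hM0 s)) hν z] at this
    simp only [partial2_comp_sub] at this
    exact ⟨this.1, this.2.1⟩
  · filter_upwards [hE] with z hz s ξ hξ
    have := hz s ξ hξ
    rw [S.rhoN_eq_shift (Nat.cast_pos.2 (hN0 s)) (Nat.cast_pos.2 (hM0 s)) hν z] at this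
    simp only [partial2_comp_sub] at this
    exact ⟨this.1, this.2.1⟩

lemma dNCE_eq_shift (hN0 : ∀ s, 0 < N s) (hM0 : ∀ s, 0 < M s) (hν : 0 < ν) (s : ℕ) :
    S.dNCE (N s) (M s) = fun ξ => ∫ z, S.rhoD 1 ν z (ξ - sizeShift ν N M s) ∂S.dataLaw
      + (M s : ℝ) / (N s : ℝ) * ∫ z, S.rhoN 1 ν z (ξ - sizeShift ν N M s) ∂S.noiseLaw := by
  ext ξ
  simp only [dNCE, S.rhoD_eq_shift (Nat.cast_pos.2 (hN0 s)) (Nat.cast_pos.2 (hM0 s)) hν,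
    S.rhoN_eq_shift (Nat.cast_pos.2 (hN0 s)) (Nat.cast_pos.2 (hM0 s)) hν, sizeShift]

lemma dHat_eq_shift (hN0 : ∀ s, 0 < N s) (hM0 : ∀ s, 0 < M s) (hν : 0 < ν) (s : ℕ)
    (x y : ℕ → 𝒳) : S.dHat (N s) (M s) x y = fun ξ => twoSampleAvg (N s) (M s) x y
      (fun z => S.rhoD 1 ν z (ξ - sizeShift ν N M s))
      fun z => S.rhoN 1 ν z (ξ - sizeShift ν N M s) := by
  ext ξ
  simp only [dHat, twoSampleAvg, one_div,
    S.rhoD_eq_shift (Nat.cast_pos.2 (hN0 s)) (Nat.cast_pos.2 (hM0 s)) hν,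
    S.rhoN_eq_shift (Nat.cast_pos.2 (hN0 s)) (Nat.cast_pos.2 (hM0 s)) hν, sizeShift]

/-- Convergence of the gradient moments, in terms of the losses at the limiting ratio. -/
lemma tendsto_sq_partial1_of_gradMomentsConverge (hN0 : ∀ s, 0 < N s) (hM0 : ∀ s, 0 < M s)
    (hν : 0 < ν) {ξs : ℕ → Param d} {ξ0 : Param d} (h : S.GradMomentsConverge N M ν ξs ξ0)
    (i : Fin (d + 1)) :
    ((∀ s, Integrable (fun z => partial1 (S.rhoD 1 ν z) i (ξs s - sizeShift ν N M s) ^ 2)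
        S.dataLaw) ∧
      Tendsto (fun s => ∫ z, partial1 (S.rhoD 1 ν z) i (ξs s - sizeShift ν N M s) ^ 2 ∂S.dataLaw)
        atTop (𝓝 (∫ z, partial1 (S.rhoD 1 ν z) i ξ0 ^ 2 ∂S.dataLaw))) ∧
    (∀ s, Integrable (fun z => partial1 (S.rhoN 1 ν z) i (ξs s - sizeShift ν N M s) ^ 2)
        S.noiseLaw) ∧
      Tendsto (fun s => ∫ z, partial1 (S.rhoN 1 ν z) i (ξs s - sizeShift ν N M s) ^ 2 ∂S.noiseLaw)
        atTop (𝓝 (∫ z, partial1 (S.rhoN 1 ν z) i ξ0 ^ 2 ∂S.noiseLaw)) := by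
  obtain ⟨hfin, hD, hE⟩ := h
  have hDi := tendsto_pi_nhds.1 (tendsto_pi_nhds.1 hD i) i
  have hEi := tendsto_pi_nhds.1 (tendsto_pi_nhds.1 hE i) i
  have hd : ∀ s z, partial1 (S.rhoD (N s) (M s) z) i (ξs s)
      = partial1 (S.rhoD 1 ν z) i (ξs s - sizeShift ν N M s) := fun s z => by
    rw [S.rhoD_eq_shift (Nat.cast_pos.2 (hN0 s)) (Nat.cast_pos.2 (hM0 s)) hν z, partial1_comp_sub,
      sizeShift]
  have hn : ∀ s z, partial1 (S.rhoN (N s) (M s) z) i (ξs s)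
      = partial1 (S.rhoN 1 ν z) i (ξs s - sizeShift ν N M s) := fun s z => by
    rw [S.rhoN_eq_shift (Nat.cast_pos.2 (hN0 s)) (Nat.cast_pos.2 (hM0 s)) hν z, partial1_comp_sub,
      sizeShift]
  simp only [gradMomentD, gradMomentN, Matrix.of_apply, hd, hn, ← sq] at hDi hEi
  refine ⟨⟨fun s => ?_, hDi⟩, fun s => ?_, hEi⟩
  · simpa only [hd, ← sq] using (hfin s).1 i i
  · simpa only [hn, ← sq] using (hfin s).2 i i

end Losses

end NCESetting

end

/-! ### Asymptotic normality of the NCE estimator. -/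

theorem lemma1 {𝒳 : Type*} [MeasurableSpace 𝒳] {d : ℕ} (S : NCESetting 𝒳 d)
    {Ω : Type*} [MeasurableSpace Ω] (P : Measure Ω) [IsProbabilityMeasure P]
    -- independent data `X` from `q` and noise `Y` from `n`
    (X Y : ℕ → Ω → 𝒳)
    (hX : ∀ t, HasLaw (X t) S.dataLaw P) (hY : ∀ t, HasLaw (Y t) S.noiseLaw P)
    (hXY : iIndepFun (Sum.elim X Y) P)
    -- sample sizes with `N, M → ∞` and `M / N → ν ∈ (0, ∞)`
    (N M : ℕ → ℕ) (hN0 : ∀ s, 0 < N s) (hM0 : ∀ s, 0 < M s)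
    (hN : Tendsto N atTop atTop) (hM : Tendsto M atTop atTop)
    (ν : ℝ) (hν : 0 < ν)
    (hNM : Tendsto (fun s => (M s : ℝ) / (N s : ℝ)) atTop (𝓝 ν))
    -- the compact set of parameters `ξ = (θ, c)` over which the criteria are minimized
    (K : Set (NCESetting.Param d)) (hK : IsCompact K)
    (hKΘ : ∀ ξ ∈ K, NCESetting.thetaPart ξ ∈ S.Θ)
    -- minimizers of the discrepancy for the sizes `(N s, M s)`
    (ξs : ℕ → NCESetting.Param d)
    (hξs : ∀ s, ξs s ∈ K ∧ IsMinOn (S.dNCE (N s) (M s)) K (ξs s))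
    -- the unique minimizer for the limiting ratio `ν`
    (ξ0 : NCESetting.Param d) (hξ0 : ξ0 ∈ interior K)
    (hmin : ∀ ξ ∈ K, ξ ≠ ξ0 → S.dNCE 1 ν ξ0 < S.dNCE 1 ν ξ)
    -- the estimator
    (ξhat : ℕ → Ω → NCESetting.Param d) (hmeas : ∀ s, AEMeasurable (ξhat s) P)
    (hξhat : ∀ s, ∀ᵐ ω ∂P, ξhat s ω ∈ K ∧
      IsMinOn (S.dHat (N s) (M s) (fun t => X t ω) (fun t => Y t ω)) K (ξhat s ω))
    -- regularity conditions
    (h1 : S.N1) (h2 : S.N2) (h3 : S.N3 ν ξ0) (h4 : S.N4 K N M) (h5 : S.N5 ν ξ0)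
    -- the drift of the minimizers `ξs` with `M / N` is under control (automatic if `ξs = ξ0`)
    (hdrift : (fun s => (M s : ℝ) / (N s : ℝ) - ν) =O[atTop] (fun s => (√(N s : ℝ))⁻¹) ∨
      S.GradMomentsConverge N M ν ξs ξ0) :
    TendstoInDistribution
      (fun s ω => √((N s : ℝ) + (M s : ℝ)) • (ξhat s ω - ξs s)) atTop id (fun _ => P)
      (multivariateGaussian 0 ((S.J 1 ν ξ0)⁻¹ * S.I 1 ν ξ0 * (S.J 1 ν ξ0)⁻¹)) ∧
    TendstoInDistribution
      (fun s ω => √(N s : ℝ) • (ξhat s ω - ξs s)) atTop id (fun _ => P)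
      (multivariateGaussian 0
        ((1 + ν)⁻¹ • ((S.J 1 ν ξ0)⁻¹ * S.I 1 ν ξ0 * (S.J 1 ν ξ0)⁻¹))) := by
  have h : NCESetting.TwoSample P S.dataLaw S.noiseLaw X Y N M ν :=
    ⟨hX, hY, hXY, hN0, hM0, hN, hM, hν, hNM⟩
  obtain ⟨δ, hf, hg⟩ := NCESetting.exists_smoothLoss hK hKΘ hN0 hM0 hν hNM hξ0 h2 h4
  have hmem : ξ0 ∈ Metric.ball ξ0 δ := Metric.mem_ball_self hf.pos
  have hf2 : ∀ i, MemLp (fun z => NCESetting.partial1 (S.rhoD 1 ν z) i ξ0) 2 S.dataLaw :=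
    fun i => (memLp_two_iff_integrable_sq
      (hf.measurable_partial1 hmem i).aestronglyMeasurable).2 (by simpa only [sq] using h3.1 i i)
  have hg2 : ∀ i, MemLp (fun z => NCESetting.partial1 (S.rhoN 1 ν z) i ξ0) 2 S.noiseLaw :=
    fun i => (memLp_two_iff_integrable_sq
      (hg.measurable_partial1 hmem i).aestronglyMeasurable).2 (by simpa only [sq] using h3.2 i i)
  have hν1 : (1 + ν : ℝ) ≠ 0 := by positivity
  have hH : IsUnit (NCESetting.limitHessian S.dataLaw S.noiseLaw ν (S.rhoD 1 ν) (S.rhoN 1 ν) ξ0) := by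
    have h5' : IsUnit (S.J 1 ν ξ0) := h5
    rw [S.J_one_eq, Matrix.isUnit_iff_isUnit_det, Matrix.det_smul] at h5'
    exact (Matrix.isUnit_iff_isUnit_det _).2 (isUnit_of_mul_isUnit_right h5')
  -- A free scaling sequence serves both conclusions: `√(1 + M / N)` turns `√N` into `√(N + M)`, and
  -- the constant `1` keeps `√N`.
  have hmain := fun (c : ℕ → ℝ) (c0 : ℝ) (hc : Tendsto c atTop (𝓝 c0)) =>
    NCESetting.tendstoInDistribution_estimator h hf hg hK (NCESetting.subset_shiftHull K _) hξ0
      (NCESetting.tendsto_ratioShift hν hNM) (fun s ξ => NCESetting.sub_mem_shiftHull _ s)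
      (by simpa only [NCESetting.dNCE, div_one] using hmin)
      (fun s => ⟨(hξs s).1, by
        have := (hξs s).2
        rwa [NCESetting.dNCE_eq_shift hN0 hM0 hν s] at this⟩) hmeas
      (fun s => by
        filter_upwards [hξhat s] with ω hω
        rwa [NCESetting.dHat_eq_shift hN0 hM0 hν s] at hω) hf2 hg2 hH
      (hdrift.imp_right
        fun hd => NCESetting.tendsto_sq_partial1_of_gradMomentsConverge hN0 hM0 hν hd) hc
  rw [S.J_one_eq, S.I_one_eq, NCESetting.sandwich_smul hν1 _ _ hH]
  constructor
  · have hc : Tendsto (fun s => √(1 + (M s : ℝ) / (N s : ℝ))) atTop (𝓝 √(1 + ν)) :=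
      (hNM.const_add 1).sqrt
    have := hmain _ _ hc
    rw [Real.sq_sqrt (by positivity)] at this
    convert this using 3 with s ω
    have hNs : (0 : ℝ) < N s := Nat.cast_pos.2 (hN0 s)
    rw [smul_smul, ← Real.sqrt_mul (by positivity), add_mul, one_mul, div_mul_cancel₀ _ hNs.ne']
  · rw [smul_smul, inv_mul_cancel₀ hν1]
    simpa using hmain (fun _ => 1) 1 tendsto_const_nhds
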